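/- Let $n,m$ be dimensions and let $\mathbb R^n\times\mathbb R^m$ carry the Euclidean norm. Let $L:\mathbb R^n\times\mathbb R^m\to\mathbb R$ be twice differentiable, let $\rho\in\mathbb R$ and $\beta,H,\delta,\xi\ge 0$, and assume, for all $z=(x,y)$, $\bar z=(\bar x,\bar y)$ (with the operator norm and the Loewner order): - $\nabla^2_{xx}L(z)\succeq-\rho I$ and $-\nabla^2_{yy}L(z)\succeq-\rho I$; - $\|\nabla^2L(z)\|\le\beta$ and $\|\nabla^2L(z)-\nabla^2L(\bar z)\|\le H\|z-\bar z\|$; - $\|\nabla^2_{xy}L(z)\|\le\delta$, $\ \|\nabla^2_{xx}L(x,y)-\nabla^2_{xx}L(x,\bar y)\|\le\xi\|y-\bar y\|$ and $\|\nabla^2_{yy}L(x,y)-\nabla^2_{yy}L(\bar x,y)\|\le\xi\|x-\bar x\|$. Let $\eta>0$ with $\eta>\rho$. Fix $z'=(x',y')$, let $x_0$ be a local minimizer of $L(\cdot,y')$ and $y_0$ a local maximizer of $L(x',\cdot)$, put $z_0=(x_0,y_0)$, and let $\mu\ge0$ satisfy $\nabla^2_{xx}L(x_0,y')\succeq\mu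 I$ and $-\nabla^2_{yy}L(x',y_0)\succeq\mu I$. Assume that $\xi$ is so small that $$\xi\|y_0-y'\|<\mu+\frac{\lambda_{\min}(\nabla^2_{xy}L(z_0)\nabla^2_{yx}L(z_0))}{\eta+\beta},\qquad \xi\|x_0-x'\|<\mu+\frac{\lambda_{\min}(\nabla^2_{yx}L(z_0)\nabla^2_{xy}L(z_0))}{\eta+\beta}.$$ Then the following hold. (a) For every $w=(x,y)$ the problem $\min_u\max_v\, L(u,v)+\frac\eta2\|u-x\|^2-\frac\eta2\|v-y\|^2$ has a unique solution $\mathrm{prox}_\eta(w)$. (b) With some $\alpha_0>0$, $L$ is $\alpha_0$-interaction dominant at $z_0$ in $x$ and in $y$, i.e. $$\nabla^2_{xx}L(z_0)+\nabla^2_{xy}L(z_0)(\eta I-\nabla^2_{yy}L(z_0))^{-1}\nabla^2_{yx}L(z_0)\succeq\alpha_0I,$$ $$-\nabla^2_{yy}L(z_0)+\nabla^2_{yx}L(z_0)(\eta I+\nabla^2_{xx}L(z_0))^{-1}\nabla^2_{xy}L(z_0)\succeq\alpha_0I;$$ namely, this holds when $\alpha_0$ is the smaller of the two differences (right-hand side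 minus left-hand side) of the two inequalities assumed for $\xi$. (c) Let $\alpha_0>0$ be any number for which the two conditions in (b) hold, and assume that $\delta$ is so small that $$\delta\|z_0-z'\|\le\frac{\alpha_0(\eta-\rho)}{2\left(1+\frac{4\sqrt2(\eta+\alpha_0/2)}{\alpha_0}+\frac{4\sqrt2\,\beta(\eta+\alpha_0/2)}{\alpha_0(\eta-\rho)}\right)H\left(1+\frac{2\delta}{\eta-\rho}+\frac{\delta^2}{(\eta-\rho)^2}\right)}$$ (no condition if $H=0$). Let $\lambda\in(0,1]$ with $$\lambda\le 2\,\frac{\min\{1,(\eta/\rho-1)^2\}}{2\eta/\alpha_0+1}$$ (the minimum is read as $1$ if $\rho=0$). Then the damped proximal point method $z_{k+1}=(1-\lambda)z_k+\lambda\,\mathrm{prox}_\eta(z_k)$ started at $z_0$ converges linearly to a stationary point $z^*$ of $L$ near $z_0$: $\nabla L(z^*)=0$, $$\|z^*-z_0\|\le\frac{2(\eta+\alpha_0/2)}{\alpha_0}\,\frac{\|\nabla L(z_0)\|}{\eta-\rho},$$ there is $q\in[0,1)$ with $\|z_k-z^*\|\le q^k\|z_0-z^*\|$ for all $k$, and for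 all $k\ge0$ $$\|z_k-z^*\|^2\le\left(1-\frac{2\lambda}{2\eta/\alpha_0+1}+\frac{\lambda^2}{\min\{1,(\eta/\rho-1)^2\}}\right)^k\|z_0-z^*\|^2 .$$ -/

import Mathlib

noncomputable section

namespace SaddlePPM

/-- `ℝᵈ` with the Euclidean norm. -/
abbrev Vec (d : ℕ) : Type := EuclideanSpace ℝ (Fin d)

/-- `ℝⁿ × ℝᵐ` with the Euclidean norm `‖(x, y)‖² = ‖x‖² + ‖y‖²`. -/
abbrev Pt (n m : ℕ) : Type := WithLp 2 (Vec n × Vec m)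

variable {n m : ℕ}

/-- The point `(x, y)`. -/
def pt (x : Vec n) (y : Vec m) : Pt n m := WithLp.toLp 2 (x, y)

/-- The inclusion `u ↦ (u, 0)`. -/
def inX (n m : ℕ) : Vec n →L[ℝ] Pt n m :=
  (WithLp.prodContinuousLinearEquiv 2 ℝ (Vec n) (Vec m)).symm.toContinuousLinearMap ∘L
    ContinuousLinearMap.inl ℝ (Vec n) (Vec m)

/-- The inclusion `v ↦ (0, v)`. -/
def inY (n m : ℕ) : Vec m →L[ℝ] Pt n m :=
  (WithLp.prodContinuousLinearEquiv 2 ℝ (Vec n) (Vec m)).symm.toContinuousLinearMap ∘L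
    ContinuousLinearMap.inr ℝ (Vec n) (Vec m)

/-- The projection `(x, y) ↦ x`. -/
def prX (n m : ℕ) : Pt n m →L[ℝ] Vec n := WithLp.fstL 2 ℝ (Vec n) (Vec m)

/-- The projection `(x, y) ↦ y`. -/
def prY (n m : ℕ) : Pt n m →L[ℝ] Vec m := WithLp.sndL 2 ℝ (Vec n) (Vec m)

/-- `L` is twice differentiable everywhere. -/
def TwiceDifferentiable (L : Pt n m → ℝ) : Prop :=
  Differentiable ℝ L ∧ Differentiable ℝ (gradient L)

/-- The Hessian `∇²L(z)`, the derivative of the gradient, as a linear operator on `ℝⁿ × ℝᵐ`. -/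
def hess (L : Pt n m → ℝ) (z : Pt n m) : Pt n m →L[ℝ] Pt n m := fderiv ℝ (gradient L) z

/-- The block `∇²ₓₓL(z)` (of size `n × n`). -/
def hessXX (L : Pt n m → ℝ) (z : Pt n m) : Vec n →L[ℝ] Vec n :=
  prX n m ∘L hess L z ∘L inX n m

/-- The block `∇²ₓᵧL(z)` (of size `n × m`). -/
def hessXY (L : Pt n m → ℝ) (z : Pt n m) : Vec m →L[ℝ] Vec n :=
  prX n m ∘L hess L z ∘L inY n m

/-- The block `∇²ᵧₓL(z)` (of size `m × n`). -/
def hessYX (L : Pt n m → ℝ) (z : Pt n m) : Vec n →L[ℝ] Vec m :=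
  prY n m ∘L hess L z ∘L inX n m

/-- The block `∇²ᵧᵧL(z)` (of size `m × m`). -/
def hessYY (L : Pt n m → ℝ) (z : Pt n m) : Vec m →L[ℝ] Vec m :=
  prY n m ∘L hess L z ∘L inY n m

/-- `L` is `ρ`-weakly convex-weakly concave. The order on operators is the Loewner order. -/
def WeaklyConvexConcave (L : Pt n m → ℝ) (ρ : ℝ) : Prop :=
  ∀ z, (-ρ) • ContinuousLinearMap.id ℝ (Vec n) ≤ hessXX L z ∧
    (-ρ) • ContinuousLinearMap.id ℝ (Vec m) ≤ -hessYY L z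

/-- `α`-interaction dominance in `x` at the point `z`, for the proximal parameter `η`. -/
def DominantXAt (L : Pt n m → ℝ) (η α : ℝ) (z : Pt n m) : Prop :=
  α • ContinuousLinearMap.id ℝ (Vec n) ≤ hessXX L z +
    hessXY L z ∘L (η • ContinuousLinearMap.id ℝ (Vec m) - hessYY L z).inverse ∘L hessYX L z

/-- `α`-interaction dominance in `y` at the point `z`, for the proximal parameter `η`. -/
def DominantYAt (L : Pt n m → ℝ) (η α : ℝ) (z : Pt n m) : Prop :=
  α • ContinuousLinearMap.id ℝ (Vec m) ≤ -hessYY L z +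
    hessYX L z ∘L (η • ContinuousLinearMap.id ℝ (Vec n) + hessXX L z).inverse ∘L hessXY L z

/-- The smallest eigenvalue of a symmetric operator (and `0` in dimension `0`). -/
def lamMin {d : ℕ} (A : Vec d →L[ℝ] Vec d) : ℝ :=
  sInf {t : ℝ | Module.End.HasEigenvalue (A : Vec d →ₗ[ℝ] Vec d) t}

/-- The objective of the proximal subproblem at `w = (x, y)`:
`L(u, v) + (η/2)‖u - x‖² - (η/2)‖v - y‖²`. -/
def proxObj (L : Pt n m → ℝ) (η : ℝ) (w : Pt n m) (u : Vec n) (v : Vec m) : ℝ :=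
  L (pt u v) + η / 2 * ‖u - w.fst‖ ^ 2 - η / 2 * ‖v - w.snd‖ ^ 2

/-- `p` solves `min_u max_v M(u, v)`: the inner maximum `φ(u) = max_v M(u, v)` is attained for
every `u`, the first component of `p` minimizes `φ`, and the second component of `p` attains the
inner maximum there. -/
def IsMinimax (M : Vec n → Vec m → ℝ) (p : Pt n m) : Prop :=
  ∃ φ : Vec n → ℝ, (∀ u, IsGreatest (Set.range (M u)) (φ u)) ∧
    (∀ u, φ p.fst ≤ φ u) ∧ M p.fst p.snd = φ p.fst

/-- `p = prox_η(w)`. -/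
def IsProx (L : Pt n m → ℝ) (η : ℝ) (w p : Pt n m) : Prop :=
  IsMinimax (proxObj L η w) p

/-- `z` is a sequence of iterates of the damped proximal point method,
`z_{k+1} = (1 - lam) z_k + lam prox_η(z_k)`. -/
def IsDampedPPM (L : Pt n m → ℝ) (η lam : ℝ) (z : ℕ → Pt n m) : Prop :=
  ∀ k, ∃ p, IsProx L η (z k) p ∧ z (k + 1) = (1 - lam) • z k + lam • p

end SaddlePPM

end

noncomputable section

open scoped InnerProductSpace

namespace SaddlePPM

/-! ### Strongly monotone maps -/

section Monotone

variable {E : Type*} [NormedAddCommGroup E] [InnerProductSpace ℝ E]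

/-! Put F = (∇ₓL, -∇ᵧL) (`field`). In ⟨F'(z)v, v⟩ the mixed blocks cancel, so weak
convexity-concavity makes ηI + F strongly monotone with modulus η - ρ. Being Lipschitz as well, it
is a bijection, and its inverse at ηw is the proximal point of w (`isProx_iff`); this is (a). For
(b), the bound (ηI - ∇²ᵧᵧL)⁻¹ ⪰ (η+β)⁻¹I and its analogue in x bound the interaction terms below,
and ξ controls the change of the diagonal blocks.

For (c), the damped step has derivative v ↦ v - λ(v - ηu) with (ηI + F'(p))u = v, where p is the
proximal point. Monotonicity alone gives ‖v - ηu‖² ≤ ‖v‖²/M with M = min{1, (η/ρ-1)²}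
(`norm_sub_resolvent_sq_le`). If α-dominance holds at p, then also ⟨u, v⟩ ≤ ‖v‖²/(η+α)
(`inner_shiftJac_le`): ηI + F'(p) has off-diagonal blocks B and -Bᵀ, so the off-diagonal part of its
inverse is skew and drops out of the quadratic form, while the diagonal blocks of the inverse are
inverses of Schur complements, each at least (η+α)I. Expanding the square yields the squared
contraction factor 1 - 2λ/(η/α+1) + λ²/M.

Dominance is known only at z₀. A Schur complement is the maximum of a quadratic form in the Hessian,
attained at a vector of length at most κ‖x‖, κ = δ/(η-ρ); hence changing the Hessian by c costs at
most c(1+κ²) (`VarDominantX.perturb`). As ‖∇L(z₀)‖ ≤ δ‖z₀-z'‖ (`norm_gradient_le`), the proximal map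
sends a suitable ball about z₀ close to z₀, and there a coefficient α₁ > α₀/2 survives. Banach's
theorem on the ball of half the radius gives z*, and the iterates never leave the full ball. The
strict gap between α₁ and α₀/2 keeps q < 1 even at the largest admissible λ, where the stated rate
may equal 1. -/

/-- A map whose derivative is uniformly coercive is strongly monotone. -/
theorem strongly_monotone_of_hasFDerivAt {G : E → E} {G' : E → E →L[ℝ] E} {m : ℝ}
    (hG : ∀ z, HasFDerivAt G (G' z) z) (hm : ∀ z v, m * ‖v‖ ^ 2 ≤ ⟪G' z v, v⟫_ℝ) (a b : E) :
    m * ‖a - b‖ ^ 2 ≤ ⟪G a - G b, a - b⟫_ℝ := by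
  have hd : ∀ t : ℝ, HasDerivAt (fun t : ℝ => ⟪G (b + t • (a - b)), a - b⟫_ℝ - m * ‖a - b‖ ^ 2 * t)
      (⟪G' (b + t • (a - b)) (a - b), a - b⟫_ℝ - m * ‖a - b‖ ^ 2) t := by
    intro t
    have h1 : HasDerivAt (fun t : ℝ => b + t • (a - b)) (a - b) t := by
      simpa using ((hasDerivAt_id t).smul_const (a - b)).const_add b
    have h2 := (hG (b + t • (a - b))).comp_hasDerivAt t h1
    have h3 := h2.inner ℝ (hasDerivAt_const t (a - b))
    have h4 := h3.sub ((hasDerivAt_id t).const_mul (m * ‖a - b‖ ^ 2))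
    exact h4.congr_deriv (by simp)
  have hmono := monotone_of_hasDerivAt_nonneg hd fun t => sub_nonneg.2 (hm _ _)
  have h := hmono zero_le_one
  simp only [zero_smul, add_zero, mul_zero, sub_zero, one_smul, mul_one, add_sub_cancel] at h
  rw [inner_sub_left]
  linarith

theorem norm_le_of_strongly_monotone {G : E → E} {m : ℝ}
    (hm : ∀ a b, m * ‖a - b‖ ^ 2 ≤ ⟪G a - G b, a - b⟫_ℝ) (a b : E) :
    m * ‖a - b‖ ≤ ‖G a - G b‖ := by
  rcases (norm_nonneg (a - b)).eq_or_lt with h | h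
  · rw [← h]; simp
  · have h1 := (hm a b).trans (real_inner_le_norm _ _)
    rw [pow_two, ← mul_assoc] at h1
    exact le_of_mul_le_mul_right h1 h

/-- A strongly monotone Lipschitz map of a Hilbert space is onto. -/
theorem surjective_of_strongly_monotone [CompleteSpace E] {G : E → E} {m K : ℝ} (hm0 : 0 < m)
    (hm : ∀ a b, m * ‖a - b‖ ^ 2 ≤ ⟪G a - G b, a - b⟫_ℝ)
    (hK : ∀ a b, ‖G a - G b‖ ≤ K * ‖a - b‖) : Function.Surjective G := by
  intro y
  have hD : 0 < K ^ 2 + m ^ 2 := by positivity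
  -- The step m/K² would minimize 1 - 2sm + s²K²; the extra m² keeps the denominator positive when K
  -- = 0 and still gives the factor 1 - sm.
  set s := m / (K ^ 2 + m ^ 2) with hs
  have hs0 : 0 < s := by positivity
  set q := √(K ^ 2 / (K ^ 2 + m ^ 2)) with hq
  have hq1 : q < 1 := by
    rw [hq, Real.sqrt_lt' one_pos, one_pow, div_lt_one hD]
    have : 0 < m ^ 2 := by positivity
    linarith
  have hq0 : 0 ≤ q := Real.sqrt_nonneg _
  have hc : ContractingWith q.toNNReal (fun x => x - s • (G x - y)) := by
    refine ⟨Real.toNNReal_lt_one.2 hq1, LipschitzWith.of_dist_le_mul fun a b => ?_⟩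
    rw [dist_eq_norm, dist_eq_norm, Real.coe_toNNReal q hq0]
    have e : a - s • (G a - y) - (b - s • (G b - y)) = (a - b) - s • (G a - G b) := by
      module
    rw [e]
    refine le_of_sq_le_sq ?_ (by positivity)
    have h3 : q ^ 2 = 1 - 2 * s * m + s * m := by
      rw [hq, Real.sq_sqrt (by positivity), hs]
      field_simp
      ring
    rw [norm_sub_sq_real, mul_pow, h3, inner_smul_right, norm_smul, mul_pow, real_inner_comm]
    have h1 := hm a b
    have h2 : ‖G a - G b‖ ^ 2 ≤ K ^ 2 * ‖a - b‖ ^ 2 := by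
      rw [← mul_pow]; exact pow_le_pow_left₀ (norm_nonneg _) (hK a b) 2
    rw [Real.norm_of_nonneg hs0.le]
    have h4 : s ^ 2 * K ^ 2 ≤ s * m := by
      have : s * (K ^ 2 + m ^ 2) = m := by rw [hs]; field_simp
      nlinarith [mul_pos hs0 hs0, sq_nonneg (s * m)]
    nlinarith [mul_le_mul_of_nonneg_left h2 (sq_nonneg s), mul_le_mul_of_nonneg_left h1 hs0.le,
      mul_le_mul_of_nonneg_right h4 (sq_nonneg ‖a - b‖)]
  have hfix := hc.fixedPoint_isFixedPt
  refine ⟨hc.fixedPoint, ?_⟩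
  have h : s • (G hc.fixedPoint - y) = 0 := sub_eq_self.1 hfix
  rcases smul_eq_zero.1 h with h | h
  · exact absurd h hs0.ne'
  · exact sub_eq_zero.1 h

/-- A critical point of a function with strongly monotone gradient is the strict minimizer. -/
theorem lt_of_strongly_monotone_gradient [CompleteSpace E] {f : E → ℝ} {g : E → E} {m : ℝ}
    (hm0 : 0 < m) (hf : ∀ z, HasGradientAt f (g z) z)
    (hm : ∀ a b, m * ‖a - b‖ ^ 2 ≤ ⟪g a - g b, a - b⟫_ℝ) {a b : E} (ha : g a = 0) (hab : b ≠ a) :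
    f a < f b := by
  have hd : ∀ t : ℝ, HasDerivAt (fun t : ℝ => f (a + t • (b - a)))
      ⟪g (a + t • (b - a)), b - a⟫_ℝ t := by
    intro t
    have h1 : HasDerivAt (fun t : ℝ => a + t • (b - a)) (b - a) t := by
      simpa using ((hasDerivAt_id t).smul_const (b - a)).const_add a
    exact ((hf (a + t • (b - a))).hasFDerivAt.comp_hasDerivAt t h1).congr_deriv (by simp)
  have hpos : ∀ t ∈ interior (Set.Icc (0 : ℝ) 1),
      0 < deriv (fun t : ℝ => f (a + t • (b - a))) t := by
    intro t ht
    rw [interior_Icc] at ht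
    rw [(hd t).deriv]
    have h := hm (a + t • (b - a)) a
    rw [ha, sub_zero, add_sub_cancel_left, inner_smul_right] at h
    have hn : 0 < ‖t • (b - a)‖ := norm_pos_iff.2 (smul_ne_zero ht.1.ne' (sub_ne_zero.2 hab))
    have h2 : 0 < t * ⟪g (a + t • (b - a)), b - a⟫_ℝ := lt_of_lt_of_le (by positivity) h
    exact (mul_pos_iff_of_pos_left ht.1).1 h2
  have hmono := strictMonoOn_of_deriv_pos (convex_Icc (0 : ℝ) 1)
    (fun t _ => (hd t).continuousAt.continuousWithinAt) hpos
  simpa using hmono (Set.left_mem_Icc.2 zero_le_one) (Set.right_mem_Icc.2 zero_le_one) one_pos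

end Monotone

/-! ### Quadratic estimates for resolvents -/

section Resolvent

variable {E F : Type*} [NormedAddCommGroup E] [InnerProductSpace ℝ E]
  [NormedAddCommGroup F] [InnerProductSpace ℝ F]

/-- A bounded-below, bounded-above symmetric operator satisfies `Q² ≤ K Q`. -/
theorem norm_sq_le_of_symmetric {Q : E →L[ℝ] E} {K : ℝ} (hK : 0 < K)
    (hsym : ∀ x y, ⟪Q x, y⟫_ℝ = ⟪x, Q y⟫_ℝ) (hpos : ∀ x, 0 ≤ ⟪Q x, x⟫_ℝ)
    (hle : ∀ x, ⟪Q x, x⟫_ℝ ≤ K * ‖x‖ ^ 2) (x : E) : ‖Q x‖ ^ 2 / K ≤ ⟪Q x, x⟫_ℝ := by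
  -- Expands to ⟨Qx, x⟩ - 2‖Qx‖²/K + ⟨Q(Qx), Qx⟩/K² ≥ 0, whose last term is at most ‖Qx‖²/K.
  have h := hpos (x - K⁻¹ • Q x)
  simp only [map_sub, map_smul, inner_sub_left, inner_sub_right, real_inner_smul_left,
    real_inner_smul_right] at h
  rw [hsym (Q x) x, real_inner_self_eq_norm_sq] at h
  have h2 := hle (Q x)
  have h3 : K⁻¹ * (K⁻¹ * ⟪Q (Q x), Q x⟫_ℝ) ≤ K⁻¹ * ‖Q x‖ ^ 2 := by
    rw [← mul_assoc]
    calc K⁻¹ * K⁻¹ * ⟪Q (Q x), Q x⟫_ℝ ≤ K⁻¹ * K⁻¹ * (K * ‖Q x‖ ^ 2) := by gcongr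
      _ = K⁻¹ * ‖Q x‖ ^ 2 := by field_simp
  rw [div_eq_inv_mul]
  linarith

/-- The reflection `w - η u` of the resolvent `u` of an operator bounded below by `-ρ`. -/
theorem norm_sub_resolvent_sq_le {ρ η : ℝ} (hη : 0 < η) (hηρ : ρ < η) {u w : E}
    (h : (η - ρ) * ‖u‖ ^ 2 ≤ ⟪w, u⟫_ℝ) :
    ‖w - η • u‖ ^ 2 * min 1 ((η / ρ - 1) ^ 2) ≤ ‖w‖ ^ 2 := by
  have e : ‖w - η • u‖ ^ 2 = ‖w‖ ^ 2 - 2 * η * ⟪w, u⟫_ℝ + η ^ 2 * ‖u‖ ^ 2 := by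
    rw [norm_sub_sq_real, real_inner_smul_right, norm_smul, mul_pow, Real.norm_of_nonneg hη.le]
    ring
  have hle : ‖w - η • u‖ ^ 2 ≤ ‖w‖ ^ 2 + η * (2 * ρ - η) * ‖u‖ ^ 2 := by
    rw [e]; nlinarith [mul_le_mul_of_nonneg_left h hη.le]
  -- The sign of η(2ρ - η) decides: either the ‖u‖² term can be dropped, or ‖u‖ ≤ ‖w‖/(η-ρ) is
  -- inserted and (η-ρ)² + η(2ρ-η) = ρ².
  by_cases h2 : 2 * ρ ≤ η
  · have h3 : ‖w - η • u‖ ^ 2 ≤ ‖w‖ ^ 2 := by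
      have : 0 ≤ η * (η - 2 * ρ) * ‖u‖ ^ 2 :=
        mul_nonneg (mul_nonneg hη.le (by linarith)) (sq_nonneg _)
      nlinarith
    calc _ ≤ ‖w - η • u‖ ^ 2 * 1 := by gcongr; exact min_le_left _ _
      _ ≤ _ := by rwa [mul_one]
  · push Not at h2
    have hρ : 0 < ρ := by linarith
    have hd : 0 < η - ρ := by linarith
    have hu : (η - ρ) * ‖u‖ ≤ ‖w‖ := by
      rcases (norm_nonneg u).eq_or_lt with h0 | h0
      · rw [← h0]; simp
      · have := h.trans (real_inner_le_norm _ _)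
        rw [pow_two, ← mul_assoc] at this
        exact le_of_mul_le_mul_right this h0
    have hu2 : (η - ρ) ^ 2 * ‖u‖ ^ 2 ≤ ‖w‖ ^ 2 := by
      rw [← mul_pow]; exact pow_le_pow_left₀ (by positivity) hu 2
    have h4 : ‖w - η • u‖ ^ 2 * (η - ρ) ^ 2 ≤ ρ ^ 2 * ‖w‖ ^ 2 := by
      have h5 : 0 ≤ η * (2 * ρ - η) := mul_nonneg hη.le (by linarith)
      nlinarith [mul_le_mul_of_nonneg_left hu2 h5,
        mul_le_mul_of_nonneg_right hle (sq_nonneg (η - ρ))]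
    calc _ ≤ ‖w - η • u‖ ^ 2 * (η / ρ - 1) ^ 2 := by gcongr; exact min_le_right _ _
      _ = (‖w - η • u‖ ^ 2 * (η - ρ) ^ 2) / ρ ^ 2 := by field_simp
      _ ≤ _ := by rw [div_le_iff₀ (by positivity)]; linarith

/-- Dominance bounds the quadratic form of the inverse of a Schur complement. -/
theorem inner_schur_le {A : E →L[ℝ] E} {B : F →L[ℝ] E} {B' : E →L[ℝ] F} {C : F →L[ℝ] F}
    {η α : ℝ} (hηα : 0 < η + α) (hB : ∀ x u, ⟪B u, x⟫_ℝ = ⟪u, B' x⟫_ℝ)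
    (hCsym : ∀ x y, ⟪C x, y⟫_ℝ = ⟪x, C y⟫_ℝ) (hC : ∀ u, 0 ≤ η * ‖u‖ ^ 2 + ⟪C u, u⟫_ℝ)
    (hdom : ∀ x, ∃ u, α * ‖x‖ ^ 2 ≤
      ⟪A x, x⟫_ℝ + 2 * ⟪B u, x⟫_ℝ - (η * ‖u‖ ^ 2 + ⟪C u, u⟫_ℝ))
    {x w : E} {u : F} (hu : η • u + C u = B' x) (hw : η • x + A x + B u = w) :
    ⟪x, w⟫_ℝ ≤ ‖w‖ ^ 2 / (η + α) := by
  obtain ⟨v, hv⟩ := hdom x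
  -- Completing the square: the solution u maximizes the form in `hdom`, so it does at least as well
  -- as the given v.
  have h1 := hC (v - u)
  have e1 : ⟪B v, x⟫_ℝ = η * ⟪v, u⟫_ℝ + ⟪v, C u⟫_ℝ := by
    rw [hB, ← hu, inner_add_right, real_inner_smul_right]
  have e2 : ⟪B u, x⟫_ℝ = η * ‖u‖ ^ 2 + ⟪C u, u⟫_ℝ := by
    rw [hB, ← hu, inner_add_right, real_inner_smul_right, real_inner_self_eq_norm_sq,
      real_inner_comm (C u) u]
  have e3 : η * ‖v - u‖ ^ 2 + ⟪C (v - u), v - u⟫_ℝ =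
      (η * ‖v‖ ^ 2 + ⟪C v, v⟫_ℝ) - 2 * (η * ⟪v, u⟫_ℝ + ⟪v, C u⟫_ℝ) +
        (η * ‖u‖ ^ 2 + ⟪C u, u⟫_ℝ) := by
    rw [norm_sub_sq_real, map_sub, inner_sub_left, inner_sub_right, inner_sub_right,
      hCsym v u, real_inner_comm v (C u)]
    ring
  have e4 : ⟪x, w⟫_ℝ = η * ‖x‖ ^ 2 + ⟪A x, x⟫_ℝ + ⟪B u, x⟫_ℝ := by
    rw [real_inner_comm, ← hw, inner_add_left, inner_add_left, real_inner_smul_left,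
      real_inner_self_eq_norm_sq]
  have h2 : (η + α) * ‖x‖ ^ 2 ≤ ⟪x, w⟫_ℝ := by rw [e4]; linarith
  have h3 := h2.trans (real_inner_le_norm _ _)
  rcases (norm_nonneg x).eq_or_lt with h0 | h0
  · rw [norm_eq_zero.1 h0.symm, inner_zero_left]; positivity
  have h4 : (η + α) * ‖x‖ ≤ ‖w‖ := by
    refine le_of_mul_le_mul_right ?_ h0
    linarith
  rw [le_div_iff₀ hηα]
  nlinarith [real_inner_le_norm x w, norm_nonneg w,
    mul_le_mul_of_nonneg_right h4 (norm_nonneg w)]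

end Resolvent

variable {n m : ℕ}

/-! ### The product space and its coordinates -/

section Coordinates

@[simp] theorem pt_fst (x : Vec n) (y : Vec m) : (pt x y).fst = x := rfl

@[simp] theorem pt_snd (x : Vec n) (y : Vec m) : (pt x y).snd = y := rfl

@[simp] theorem prX_apply (z : Pt n m) : prX n m z = z.fst := rfl

@[simp] theorem prY_apply (z : Pt n m) : prY n m z = z.snd := rfl

theorem pt_ext {z w : Pt n m} (h1 : z.fst = w.fst) (h2 : z.snd = w.snd) : z = w :=
  WithLp.ofLp_injective 2 (Prod.ext h1 h2)

@[simp] theorem inX_fst (x : Vec n) : (inX n m x).fst = x := rfl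

@[simp] theorem inX_snd (x : Vec n) : (inX n m x).snd = 0 := rfl

@[simp] theorem inY_fst (y : Vec m) : (inY n m y).fst = 0 := rfl

@[simp] theorem inY_snd (y : Vec m) : (inY n m y).snd = y := rfl

theorem inX_add_inY (z : Pt n m) : inX n m z.fst + inY n m z.snd = z :=
  pt_ext (by simp) (by simp)

theorem pt_eq_add (x : Vec n) (y : Vec m) : pt x y = inX n m x + inY n m y :=
  pt_ext (by simp) (by simp)

theorem inner_pt (z w : Pt n m) : ⟪z, w⟫_ℝ = ⟪z.fst, w.fst⟫_ℝ + ⟪z.snd, w.snd⟫_ℝ :=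
  WithLp.prod_inner_apply z w

theorem norm_sq_pt (z : Pt n m) : ‖z‖ ^ 2 = ‖z.fst‖ ^ 2 + ‖z.snd‖ ^ 2 :=
  WithLp.prod_norm_sq_eq_of_L2 z

theorem norm_snd_le (z : Pt n m) : ‖z.snd‖ ≤ ‖z‖ :=
  le_of_sq_le_sq (by rw [norm_sq_pt z]; linarith [sq_nonneg ‖z.fst‖]) (norm_nonneg _)

theorem norm_inX (x : Vec n) : ‖inX n m x‖ = ‖x‖ := by
  rw [← sq_eq_sq₀ (norm_nonneg _) (norm_nonneg _), norm_sq_pt]; simp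

theorem norm_inY (y : Vec m) : ‖inY n m y‖ = ‖y‖ := by
  rw [← sq_eq_sq₀ (norm_nonneg _) (norm_nonneg _), norm_sq_pt]; simp

theorem pt_sub_pt_left (x u : Vec n) (y : Vec m) : pt x y - pt u y = inX n m (x - u) :=
  pt_ext (by simp) (by simp)

theorem pt_sub_pt_right (x : Vec n) (y v : Vec m) : pt x y - pt x v = inY n m (y - v) :=
  pt_ext (by simp) (by simp)

theorem hasFDerivAt_pt_left (x : Vec n) (y : Vec m) :
    HasFDerivAt (fun u : Vec n => pt u y) (inX n m) x := by
  have h := (inX n m).hasFDerivAt (x := x) |>.add_const (inY n m y)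
  exact h.congr_of_eventuallyEq (Filter.Eventually.of_forall fun u => pt_eq_add u y)

theorem hasFDerivAt_pt_right (x : Vec n) (y : Vec m) :
    HasFDerivAt (fun v : Vec m => pt x v) (inY n m) y := by
  have h := (inY n m).hasFDerivAt (x := y) |>.const_add (inX n m x)
  exact h.congr_of_eventuallyEq (Filter.Eventually.of_forall fun v => pt_eq_add x v)

variable (n m) in
/-- The reflection `(x, y) ↦ (x, -y)`. -/
def reflect : Pt n m →L[ℝ] Pt n m := inX n m ∘L prX n m - inY n m ∘L prY n m

@[simp] theorem reflect_fst (z : Pt n m) : (reflect n m z).fst = z.fst := by simp [reflect]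

@[simp] theorem reflect_snd (z : Pt n m) : (reflect n m z).snd = -z.snd := by simp [reflect]

theorem norm_reflect (z : Pt n m) : ‖reflect n m z‖ = ‖z‖ := by
  rw [← sq_eq_sq₀ (norm_nonneg _) (norm_nonneg _), norm_sq_pt, norm_sq_pt]; simp

end Coordinates

/-! ### Hessian blocks and the saddle gradient field -/

section Hessian

variable {L : Pt n m → ℝ} {ρ β δ η : ℝ}

theorem hess_fst (z v : Pt n m) :
    (hess L z v).fst = hessXX L z v.fst + hessXY L z v.snd := by
  conv_lhs => rw [← inX_add_inY v]
  simp [hessXX, hessXY]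

theorem hess_snd (z v : Pt n m) :
    (hess L z v).snd = hessYX L z v.fst + hessYY L z v.snd := by
  conv_lhs => rw [← inX_add_inY v]
  simp [hessYX, hessYY]

theorem inner_gradient_eq (hL : TwiceDifferentiable L) (z v : Pt n m) :
    ⟪gradient L z, v⟫_ℝ = fderiv ℝ L z v := by
  rw [← (hL.1 z).hasGradientAt.fderiv_apply]

theorem hess_symm (hL : TwiceDifferentiable L) (z v w : Pt n m) :
    ⟪hess L z v, w⟫_ℝ = ⟪v, hess L z w⟫_ℝ := by
  have h1 : ∀ y, HasFDerivAt L (innerSL ℝ (gradient L y)) y := fun y => by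
    have h := (hL.1 y).hasGradientAt.hasFDerivAt
    convert! h using 1
  have h2 : HasFDerivAt (fun y => innerSL ℝ (gradient L y)) (innerSL ℝ ∘L hess L z) z :=
    (innerSL ℝ).hasFDerivAt.comp z (hL.2 z).hasFDerivAt
  have h := second_derivative_symmetric h1 h2 v w
  calc ⟪hess L z v, w⟫_ℝ = ⟪hess L z w, v⟫_ℝ := h
    _ = ⟪v, hess L z w⟫_ℝ := real_inner_comm _ _

theorem hessXX_symm (hL : TwiceDifferentiable L) (z : Pt n m) (x u : Vec n) :
    ⟪hessXX L z x, u⟫_ℝ = ⟪x, hessXX L z u⟫_ℝ := by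
  simpa [inner_pt, hessXX] using hess_symm hL z (inX n m x) (inX n m u)

theorem hessYY_symm (hL : TwiceDifferentiable L) (z : Pt n m) (x u : Vec m) :
    ⟪hessYY L z x, u⟫_ℝ = ⟪x, hessYY L z u⟫_ℝ := by
  simpa [inner_pt, hessYY] using hess_symm hL z (inY n m x) (inY n m u)

theorem hessXY_adjoint (hL : TwiceDifferentiable L) (z : Pt n m) (x : Vec n) (u : Vec m) :
    ⟪hessXY L z u, x⟫_ℝ = ⟪u, hessYX L z x⟫_ℝ := by
  simpa [inner_pt, hessXY, hessYX] using hess_symm hL z (inY n m u) (inX n m x)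

theorem hessYX_adjoint (hL : TwiceDifferentiable L) (z : Pt n m) (x : Vec n) (u : Vec m) :
    ⟪hessYX L z x, u⟫_ℝ = ⟪x, hessXY L z u⟫_ℝ := by
  simpa [inner_pt, hessXY, hessYX] using hess_symm hL z (inX n m x) (inY n m u)

theorem norm_hessYX_le (hL : TwiceDifferentiable L) (hδ0 : 0 ≤ δ)
    (hδ : ∀ z, ‖hessXY L z‖ ≤ δ) (z : Pt n m) : ‖hessYX L z‖ ≤ δ := by
  refine ContinuousLinearMap.opNorm_le_bound _ hδ0 fun x => ?_
  rcases (norm_nonneg (hessYX L z x)).eq_or_lt with h | h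
  · rw [← h]; positivity
  refine le_of_mul_le_mul_right ?_ h
  calc ‖hessYX L z x‖ * ‖hessYX L z x‖ = ⟪hessXY L z (hessYX L z x), x⟫_ℝ := by
        rw [hessXY_adjoint hL, real_inner_self_eq_norm_mul_norm]
    _ ≤ ‖hessXY L z (hessYX L z x)‖ * ‖x‖ := real_inner_le_norm _ _
    _ ≤ δ * ‖hessYX L z x‖ * ‖x‖ := by
        gcongr; exact (hessXY L z).le_of_opNorm_le (hδ z) _
    _ = δ * ‖x‖ * ‖hessYX L z x‖ := by ring

theorem smul_id_le_iff {d : ℕ} {A : Vec d →L[ℝ] Vec d} {c : ℝ} :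
    c • ContinuousLinearMap.id ℝ (Vec d) ≤ A ↔
      (∀ x y, ⟪A x, y⟫_ℝ = ⟪x, A y⟫_ℝ) ∧ ∀ x, c * ‖x‖ ^ 2 ≤ ⟪A x, x⟫_ℝ := by
  rw [ContinuousLinearMap.le_def, ContinuousLinearMap.isPositive_iff]
  refine and_congr ⟨fun h x y => ?_, fun h x y => ?_⟩ (forall_congr' fun x => ?_)
  · have := h x y
    simpa [inner_sub_left, inner_sub_right, real_inner_smul_left, real_inner_smul_right] using this
  · simp [inner_sub_left, inner_sub_right, real_inner_smul_left, real_inner_smul_right, h x y]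
  · simp [inner_sub_left, real_inner_smul_left]

theorem WeaklyConvexConcave.hessXX_ge (h : WeaklyConvexConcave L ρ) (z : Pt n m) (x : Vec n) :
    -ρ * ‖x‖ ^ 2 ≤ ⟪hessXX L z x, x⟫_ℝ := (smul_id_le_iff.1 (h z).1).2 x

theorem WeaklyConvexConcave.hessYY_le (h : WeaklyConvexConcave L ρ) (z : Pt n m) (y : Vec m) :
    -ρ * ‖y‖ ^ 2 ≤ -⟪hessYY L z y, y⟫_ℝ := by
  simpa using (smul_id_le_iff.1 (h z).2).2 y

variable (L) in
/-- The saddle gradient field `(∇ₓL, -∇ᵧL)`. -/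
def field (z : Pt n m) : Pt n m := reflect n m (gradient L z)

variable (L) in
/-- The derivative of the saddle gradient field. -/
def jac (z : Pt n m) : Pt n m →L[ℝ] Pt n m := reflect n m ∘L hess L z

theorem hasFDerivAt_field (hL : TwiceDifferentiable L) (z : Pt n m) :
    HasFDerivAt (field L) (jac L z) z :=
  (reflect n m).hasFDerivAt.comp z (hL.2 z).hasFDerivAt

theorem jac_fst (z v : Pt n m) : (jac L z v).fst = hessXX L z v.fst + hessXY L z v.snd := by
  simp [jac, hess_fst]

theorem jac_snd (z v : Pt n m) : (jac L z v).snd = -(hessYX L z v.fst + hessYY L z v.snd) := by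
  simp only [jac, ContinuousLinearMap.comp_apply, reflect_snd, hess_snd]

/-- The mixed blocks are adjoint and enter with opposite signs, so only the diagonal blocks
contribute. -/
theorem inner_jac_ge (hL : TwiceDifferentiable L) (h : WeaklyConvexConcave L ρ) (z v : Pt n m) :
    -ρ * ‖v‖ ^ 2 ≤ ⟪jac L z v, v⟫_ℝ := by
  rw [inner_pt, jac_fst, jac_snd, norm_sq_pt, inner_add_left, inner_neg_left, inner_add_left,
    hessXY_adjoint hL, real_inner_comm (hessYX L z v.fst)]
  have h1 := h.hessXX_ge z v.fst
  have h2 := h.hessYY_le z v.snd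
  linarith

/-- The derivative of `η • id + field L`. -/
def shiftJac (L : Pt n m → ℝ) (η : ℝ) (z : Pt n m) : Pt n m →L[ℝ] Pt n m :=
  η • ContinuousLinearMap.id ℝ (Pt n m) + jac L z

/-- The map `η • id + field L`, whose inverse is the proximal map up to scaling. -/
def shift (L : Pt n m → ℝ) (η : ℝ) (z : Pt n m) : Pt n m := η • z + field L z

theorem hasFDerivAt_shift (hL : TwiceDifferentiable L) (η : ℝ) (z : Pt n m) :
    HasFDerivAt (shift L η) (shiftJac L η z) z :=
  ((hasFDerivAt_id z).const_smul η).add (hasFDerivAt_field hL z)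

theorem inner_shiftJac_ge (hL : TwiceDifferentiable L) (h : WeaklyConvexConcave L ρ)
    (z v : Pt n m) : (η - ρ) * ‖v‖ ^ 2 ≤ ⟪shiftJac L η z v, v⟫_ℝ := by
  have := inner_jac_ge hL h z v
  simp only [shiftJac, add_apply, smul_apply,
    ContinuousLinearMap.id_apply, inner_add_left, real_inner_smul_left, real_inner_self_eq_norm_sq]
  linarith

theorem shift_strongly_monotone (hL : TwiceDifferentiable L) (h : WeaklyConvexConcave L ρ)
    (a b : Pt n m) : (η - ρ) * ‖a - b‖ ^ 2 ≤ ⟪shift L η a - shift L η b, a - b⟫_ℝ :=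
  strongly_monotone_of_hasFDerivAt (hasFDerivAt_shift hL η) (inner_shiftJac_ge hL h) a b

theorem norm_field_sub_le (hL : TwiceDifferentiable L) (hβ : ∀ z, ‖hess L z‖ ≤ β)
    (a b : Pt n m) : ‖field L a - field L b‖ ≤ β * ‖a - b‖ := by
  have e : field L a - field L b = reflect n m (gradient L a - gradient L b) := by
    simp [field]
  rw [e, norm_reflect]
  exact convex_univ.norm_image_sub_le_of_norm_fderiv_le (fun z _ => hL.2 z) (fun z _ => hβ z)
    (Set.mem_univ b) (Set.mem_univ a)

theorem norm_shift_sub_le (hL : TwiceDifferentiable L) (hβ : ∀ z, ‖hess L z‖ ≤ β) (hη : 0 < η)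
    (a b : Pt n m) : ‖shift L η a - shift L η b‖ ≤ (η + β) * ‖a - b‖ := by
  have e : shift L η a - shift L η b = η • (a - b) + (field L a - field L b) := by
    simp only [shift]; module
  rw [e]
  refine (norm_add_le _ _).trans ?_
  rw [norm_smul, Real.norm_of_nonneg hη.le, add_mul]
  gcongr
  exact norm_field_sub_le hL hβ a b

end Hessian

/-! ### The proximal subproblem -/

section Prox

variable {L : Pt n m → ℝ} {ρ β η : ℝ}

theorem hasGradientAt_proxObj_left (hL : TwiceDifferentiable L) (w : Pt n m) (u : Vec n)
    (v : Vec m) : HasGradientAt (fun u => proxObj L η w u v)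
      (shift L η (pt u v) - η • w).fst u := by
  rw [hasGradientAt_iff_hasFDerivAt]
  have h1 := (hL.1 (pt u v)).hasFDerivAt.comp u (hasFDerivAt_pt_left u v)
  have h2 := (((hasFDerivAt_id u).sub_const w.fst).norm_sq.const_mul (η / 2))
  have h3 := (h1.add h2).sub_const (η / 2 * ‖v - w.snd‖ ^ 2)
  refine h3.congr_fderiv ?_
  ext a
  have h4 : fderiv ℝ L (pt u v) (inX n m a) = ⟪(gradient L (pt u v)).fst, a⟫_ℝ := by
    rw [← inner_gradient_eq hL, inner_pt]; simp
  simp [h4, shift, field]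
  ring

theorem hasGradientAt_proxObj_right (hL : TwiceDifferentiable L) (w : Pt n m) (u : Vec n)
    (v : Vec m) : HasGradientAt (fun v => -proxObj L η w u v)
      (shift L η (pt u v) - η • w).snd v := by
  rw [hasGradientAt_iff_hasFDerivAt]
  have h1 := (hL.1 (pt u v)).hasFDerivAt.comp v (hasFDerivAt_pt_right u v)
  have h2 := (((hasFDerivAt_id v).sub_const w.snd).norm_sq.const_mul (η / 2))
  have h3 := ((h1.add_const (η / 2 * ‖u - w.fst‖ ^ 2)).sub h2).neg
  refine h3.congr_fderiv ?_
  ext a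
  have h4 : fderiv ℝ L (pt u v) (inY n m a) = ⟪(gradient L (pt u v)).snd, a⟫_ℝ := by
    rw [← inner_gradient_eq hL, inner_pt]; simp
  simp [h4, shift, field]
  ring

theorem inner_shift_left_ge (hL : TwiceDifferentiable L) (h : WeaklyConvexConcave L ρ)
    (w : Pt n m) (v : Vec m) (a b : Vec n) : (η - ρ) * ‖a - b‖ ^ 2 ≤
      ⟪(shift L η (pt a v) - η • w).fst - (shift L η (pt b v) - η • w).fst, a - b⟫_ℝ := by
  have := shift_strongly_monotone (η := η) hL h (pt a v) (pt b v)
  rw [pt_sub_pt_left, norm_inX, inner_pt] at this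
  simpa using this

theorem inner_shift_right_ge (hL : TwiceDifferentiable L) (h : WeaklyConvexConcave L ρ)
    (w : Pt n m) (u : Vec n) (a b : Vec m) : (η - ρ) * ‖a - b‖ ^ 2 ≤
      ⟪(shift L η (pt u a) - η • w).snd - (shift L η (pt u b) - η • w).snd, a - b⟫_ℝ := by
  have := shift_strongly_monotone (η := η) hL h (pt u a) (pt u b)
  rw [pt_sub_pt_right, norm_inY, inner_pt] at this
  simpa using this

theorem norm_shift_right_sub_le (hL : TwiceDifferentiable L) (hβ : ∀ z, ‖hess L z‖ ≤ β)
    (hη : 0 < η) (w : Pt n m) (u : Vec n) (a b : Vec m) :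
    ‖(shift L η (pt u a) - η • w).snd - (shift L η (pt u b) - η • w).snd‖ ≤
      (η + β) * ‖a - b‖ := by
  have := (norm_snd_le _).trans (norm_shift_sub_le hL hβ hη (pt u a) (pt u b))
  rw [pt_sub_pt_right, norm_inY] at this
  simpa using this

/-- The solutions of the proximal subproblem are the zeros of its saddle gradient field. -/
theorem isProx_iff (hL : TwiceDifferentiable L) (h : WeaklyConvexConcave L ρ)
    (hβ : ∀ z, ‖hess L z‖ ≤ β) (hη : 0 < η) (hηρ : ρ < η) (w q : Pt n m) :
    IsProx L η w q ↔ shift L η q = η • w := by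
  have hm : 0 < η - ρ := sub_pos.2 hηρ
  obtain ⟨p, hp⟩ := surjective_of_strongly_monotone hm (shift_strongly_monotone hL h)
    (norm_shift_sub_le hL hβ hη) (η • w)
  have hp0 : shift L η (pt p.fst p.snd) - η • w = 0 := by
    rw [show pt p.fst p.snd = p from rfl, hp, sub_self]
  have hmin : ∀ u, u ≠ p.fst → proxObj L η w p.fst p.snd < proxObj L η w u p.snd := fun u hu =>
    lt_of_strongly_monotone_gradient (f := fun u => proxObj L η w u p.snd) hm
      (fun z => hasGradientAt_proxObj_left hL w z p.snd)
      (inner_shift_left_ge hL h w p.snd) (by rw [hp0]; rfl) hu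
  have hmax : ∀ u v v', (shift L η (pt u v) - η • w).snd = 0 → v' ≠ v →
      proxObj L η w u v' < proxObj L η w u v := fun u v v' h0 hv =>
    neg_lt_neg_iff.1 <| lt_of_strongly_monotone_gradient (f := fun v => -proxObj L η w u v) hm
      (fun z => hasGradientAt_proxObj_right hL w u z)
      (inner_shift_right_ge hL h w u) h0 hv
  have hp2 : (shift L η (pt p.fst p.snd) - η • w).snd = 0 := by rw [hp0]; rfl
  constructor
  · rintro ⟨φ, hφ, hφmin, hφq⟩
    have hφp : φ p.fst = proxObj L η w p.fst p.snd := by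
      refine (hφ p.fst).unique ⟨⟨p.snd, rfl⟩, ?_⟩
      rintro _ ⟨v, rfl⟩
      by_cases hv : v = p.snd
      · rw [hv]
      · exact (hmax _ _ _ hp2 hv).le
    -- For u ≠ `p.fst`, the value φ(u) is at least the objective at (u, `p.snd`), which strictly
    -- exceeds φ(`p.fst`).
    have hq1 : q.fst = p.fst := by
      by_contra hne
      have h1 := hmin _ hne
      have h2 := (hφ q.fst).2 ⟨p.snd, rfl⟩
      have h3 := hφmin p.fst
      linarith
    have hq2 : q.snd = p.snd := by
      by_contra hne
      have h1 := hmax _ _ _ hp2 hne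
      rw [hq1, hφp] at hφq
      linarith
    rw [pt_ext hq1 hq2, hp]
  · intro hq
    have hqp : q = p := by
      have h1 := norm_le_of_strongly_monotone (shift_strongly_monotone (η := η) hL h) q p
      rw [hq, hp, sub_self, norm_zero] at h1
      have h2 : ‖q - p‖ ≤ 0 := nonpos_of_mul_nonpos_right h1 hm
      exact sub_eq_zero.1 (norm_le_zero_iff.1 h2)
    -- A minimax solution requires the inner maximum to be attained at every u, not only at `p.fst`.
    have hex : ∀ u, ∃ v, (shift L η (pt u v) - η • w).snd = 0 := fun u =>
      surjective_of_strongly_monotone hm (inner_shift_right_ge hL h w u)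
        (norm_shift_right_sub_le hL hβ hη w u) 0
    choose V hV using hex
    have hg : ∀ u, IsGreatest (Set.range (proxObj L η w u)) (proxObj L η w u (V u)) := by
      refine fun u => ⟨⟨V u, rfl⟩, ?_⟩
      rintro _ ⟨v, rfl⟩
      by_cases hv : v = V u
      · rw [hv]
      · exact (hmax _ _ _ (hV u) hv).le
    have hVp : V p.fst = p.snd := by
      by_contra hne
      exact absurd ((hg p.fst).2 ⟨p.snd, rfl⟩) (not_le.2 (hmax _ _ _ hp2 hne))
    refine hqp ▸ ⟨fun u => proxObj L η w u (V u), hg, fun u => ?_, by simp only [hVp]⟩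
    simp only [hVp]
    refine le_trans ?_ ((hg u).2 ⟨p.snd, rfl⟩)
    by_cases hu : u = p.fst
    · rw [hu]
    · exact (hmin u hu).le

theorem exists_shift_rightInverse (hL : TwiceDifferentiable L) (h : WeaklyConvexConcave L ρ)
    (hβ : ∀ z, ‖hess L z‖ ≤ β) (hη : 0 < η) (hηρ : ρ < η) :
    ∃ P : Pt n m → Pt n m, ∀ w, shift L η (P w) = η • w :=
  Classical.skolem.1 fun w => surjective_of_strongly_monotone (sub_pos.2 hηρ)
    (shift_strongly_monotone hL h) (norm_shift_sub_le hL hβ hη) (η • w)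

theorem eq_of_shift_eq (hL : TwiceDifferentiable L) (h : WeaklyConvexConcave L ρ)
    (hηρ : ρ < η) {p q : Pt n m} (hpq : shift L η p = shift L η q) : p = q := by
  have h1 := norm_le_of_strongly_monotone (shift_strongly_monotone (η := η) hL h) p q
  rw [hpq, sub_self, norm_zero] at h1
  exact sub_eq_zero.1 (norm_le_zero_iff.1 (nonpos_of_mul_nonpos_right h1 (sub_pos.2 hηρ)))

theorem existsUnique_isProx (hL : TwiceDifferentiable L) (h : WeaklyConvexConcave L ρ)
    (hβ : ∀ z, ‖hess L z‖ ≤ β) (hη : 0 < η) (hηρ : ρ < η) (w : Pt n m) :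
    ∃! p, IsProx L η w p := by
  obtain ⟨P, hP⟩ := exists_shift_rightInverse hL h hβ hη hηρ
  refine ⟨P w, (isProx_iff hL h hβ hη hηρ w _).2 (hP w), fun q hq => ?_⟩
  refine eq_of_shift_eq (η := η) hL h hηρ ?_
  rw [(isProx_iff hL h hβ hη hηρ w _).1 hq, hP]

end Prox

/-! ### Inverses of coercive operators -/

section Coercive

variable {E : Type*} [NormedAddCommGroup E] [InnerProductSpace ℝ E]

/-- Ensures that `inverse` is the true inverse, not its default value 0. -/
theorem isInvertible_of_coercive [CompleteSpace E] {T : E →L[ℝ] E} {c : ℝ} (hc : 0 < c)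
    (hT : ∀ v, c * ‖v‖ ^ 2 ≤ ⟪T v, v⟫_ℝ) : T.IsInvertible := by
  have hmono : ∀ a b, c * ‖a - b‖ ^ 2 ≤ ⟪T a - T b, a - b⟫_ℝ := fun a b => by
    rw [← map_sub]; exact hT _
  have hsurj : Function.Surjective T := surjective_of_strongly_monotone hc hmono
    (K := ‖T‖) fun a b => by rw [← map_sub]; exact T.le_opNorm _
  have hinj : Function.Injective T := fun a b hab => by
    have h := norm_le_of_strongly_monotone hmono a b
    rw [hab, sub_self, norm_zero] at h
    exact sub_eq_zero.1 (norm_le_zero_iff.1 (nonpos_of_mul_nonpos_right h hc))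
  exact ⟨ContinuousLinearEquiv.ofBijective T (LinearMap.ker_eq_bot.2 hinj)
    (LinearMap.range_eq_top.2 hsurj), ContinuousLinearEquiv.coe_ofBijective _ _ _⟩

theorem apply_inverse_apply {T : E →L[ℝ] E} (hT : T.IsInvertible) (y : E) :
    T (T.inverse y) = y := (hT.inverse_apply_eq.1 rfl).symm

end Coercive

/-! ### Schur complements -/

section Schur

variable {d e : ℕ}

theorem lamMin_mul_le {S : Vec d →L[ℝ] Vec d} (hS : ∀ x y, ⟪S x, y⟫_ℝ = ⟪x, S y⟫_ℝ) (x : Vec d) :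
    lamMin S * ‖x‖ ^ 2 ≤ ⟪S x, x⟫_ℝ := by
  -- This also covers dimension 0, where there are no eigenvalues.
  by_cases hx : x = 0
  · simp [hx]
  have : Nontrivial (Vec d) := ⟨x, 0, hx⟩
  have hsym : (S : Vec d →ₗ[ℝ] Vec d).IsSymmetric := hS
  have hev := hsym.hasEigenvalue_iInf_of_finiteDimensional
  have hfin : {t : ℝ | Module.End.HasEigenvalue (S : Vec d →ₗ[ℝ] Vec d) t}.Finite :=
    Module.End.finite_hasEigenvalue _
  have h1 : lamMin S ≤ _ := csInf_le hfin.bddBelow hev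
  have hbdd : BddBelow (Set.range fun x : {x : Vec d // x ≠ 0} =>
      RCLike.re ⟪(S : Vec d →ₗ[ℝ] Vec d) x, (x : Vec d)⟫_ℝ / ‖(x : Vec d)‖ ^ 2) := by
    refine ⟨-‖S‖, ?_⟩
    rintro _ ⟨y, rfl⟩
    exact (abs_le.1 (S.rayleighQuotient_le_norm y)).1
  have h2 := h1.trans (ciInf_le hbdd ⟨x, hx⟩)
  rwa [le_div_iff₀ (by positivity)] at h2

variable {A : Vec d →L[ℝ] Vec d} {B : Vec e →L[ℝ] Vec d} {B' : Vec d →L[ℝ] Vec e}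
  {Q : Vec e →L[ℝ] Vec e} {c K a α δ : ℝ}

/-- A lower bound for a Schur complement. -/
theorem smul_id_le_schur (hc : 0 < c) (hK : 0 < K)
    (hA : a • ContinuousLinearMap.id ℝ (Vec d) ≤ A)
    (hB : ∀ x u, ⟪B u, x⟫_ℝ = ⟪u, B' x⟫_ℝ) (hQ : ∀ x y, ⟪Q x, y⟫_ℝ = ⟪x, Q y⟫_ℝ)
    (hQc : ∀ x, c * ‖x‖ ^ 2 ≤ ⟪Q x, x⟫_ℝ) (hQK : ∀ x, ⟪Q x, x⟫_ℝ ≤ K * ‖x‖ ^ 2) :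
    (a + lamMin (B ∘L B') / K) • ContinuousLinearMap.id ℝ (Vec d) ≤ A + B ∘L Q.inverse ∘L B' := by
  rw [smul_id_le_iff] at hA ⊢
  have hinv := apply_inverse_apply (isInvertible_of_coercive hc hQc)
  have hinvsym : ∀ x y, ⟪Q.inverse x, y⟫_ℝ = ⟪x, Q.inverse y⟫_ℝ := fun x y => by
    conv_lhs => rw [← hinv y]
    rw [← hQ, hinv]
  have hB2 : ∀ x u, ⟪x, B u⟫_ℝ = ⟪B' x, u⟫_ℝ := fun x u => by
    rw [real_inner_comm, hB, real_inner_comm]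
  refine ⟨fun x y => ?_, fun x => ?_⟩
  · simp only [add_apply, ContinuousLinearMap.comp_apply, inner_add_left, inner_add_right,
      hA.1 x y, hB, hB2, hinvsym]
  · have h1 := hA.2 x
    have h2 := lamMin_mul_le (S := B ∘L B') (fun x y => by
      simp only [ContinuousLinearMap.comp_apply, hB, hB2]) x
    -- Applied at Q⁻¹B'x, the inequality Q² ≤ KQ becomes ⟨Q⁻¹B'x, B'x⟩ ≥ ‖B'x‖²/K.
    have h3 := norm_sq_le_of_symmetric hK hQ
      (fun x => (by positivity : 0 ≤ c * ‖x‖ ^ 2).trans (hQc x)) hQK (Q.inverse (B' x))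
    rw [hinv] at h3
    simp only [add_apply, ContinuousLinearMap.comp_apply, inner_add_left, hB,
      real_inner_self_eq_norm_sq] at h2 ⊢
    rw [real_inner_comm] at h3
    have h4 : lamMin (B ∘L B') / K * ‖x‖ ^ 2 ≤ ‖B' x‖ ^ 2 / K := by
      rw [div_mul_eq_mul_div]; gcongr
    rw [add_mul]
    linarith

/-- The variational form of a lower bound for a Schur complement. -/
theorem exists_le_of_smul_id_le_schur (hc : 0 < c)
    (hB : ∀ x u, ⟪B u, x⟫_ℝ = ⟪u, B' x⟫_ℝ)
    (hQc : ∀ x, c * ‖x‖ ^ 2 ≤ ⟪Q x, x⟫_ℝ) (hB' : ‖B'‖ ≤ δ)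
    (h : α • ContinuousLinearMap.id ℝ (Vec d) ≤ A + B ∘L Q.inverse ∘L B') (x : Vec d) :
    ∃ u, ‖u‖ ≤ δ / c * ‖x‖ ∧ α * ‖x‖ ^ 2 ≤ ⟪A x, x⟫_ℝ + 2 * ⟪B u, x⟫_ℝ - ⟪Q u, u⟫_ℝ := by
  have hinv := apply_inverse_apply (isInvertible_of_coercive hc hQc)
  -- The maximizer of u ↦ 2⟨Bu, x⟩ - ⟨Qu, u⟩.
  refine ⟨Q.inverse (B' x), ?_, ?_⟩
  · have h1 := norm_le_of_strongly_monotone (G := Q) (m := c)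
      (fun a b => by rw [← map_sub]; exact hQc _) (Q.inverse (B' x)) 0
    rw [map_zero, sub_zero, sub_zero, hinv] at h1
    have h2 := B'.le_of_opNorm_le hB' x
    rw [div_mul_eq_mul_div, le_div_iff₀ hc]
    linarith
  · have h1 := (smul_id_le_iff.1 h).2 x
    simp only [add_apply, ContinuousLinearMap.comp_apply, inner_add_left] at h1
    have h2 : ⟪Q (Q.inverse (B' x)), Q.inverse (B' x)⟫_ℝ = ⟪B (Q.inverse (B' x)), x⟫_ℝ := by
      rw [hinv, hB, real_inner_comm]
    linarith

end Schur

/-! ### Interaction dominance -/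

section Dominance

variable {L : Pt n m → ℝ} {ρ β δ η α μ ξ : ℝ}

theorem inner_hess_pt (hL : TwiceDifferentiable L) (z : Pt n m) (x : Vec n) (u : Vec m) :
    ⟪hess L z (pt x u), pt x u⟫_ℝ =
      ⟪hessXX L z x, x⟫_ℝ + 2 * ⟪hessXY L z u, x⟫_ℝ + ⟪hessYY L z u, u⟫_ℝ := by
  rw [inner_pt, hess_fst, hess_snd]
  simp only [pt_fst, pt_snd, inner_add_left]
  rw [hessYX_adjoint hL, real_inner_comm (hessXY L z u) x]
  ring

variable (L) in
/-- Interaction dominance in `x` in variational form: the Schur complement is a supremum. -/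
def VarDominantX (η α κ : ℝ) (z : Pt n m) : Prop :=
  ∀ x, ∃ u, ‖u‖ ≤ κ * ‖x‖ ∧ α * ‖x‖ ^ 2 ≤ ⟪hess L z (pt x u), pt x u⟫_ℝ - η * ‖u‖ ^ 2

variable (L) in
/-- Interaction dominance in `y` in variational form. -/
def VarDominantY (η α κ : ℝ) (z : Pt n m) : Prop :=
  ∀ y, ∃ v, ‖v‖ ≤ κ * ‖y‖ ∧ α * ‖y‖ ^ 2 ≤ -⟪hess L z (pt v y), pt v y⟫_ℝ - η * ‖v‖ ^ 2

theorem coercive_shift_YY (h : WeaklyConvexConcave L ρ) (z : Pt n m) (y : Vec m) :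
    (η - ρ) * ‖y‖ ^ 2 ≤ ⟪(η • ContinuousLinearMap.id ℝ (Vec m) - hessYY L z) y, y⟫_ℝ := by
  have := h.hessYY_le z y
  simp only [sub_apply, smul_apply, ContinuousLinearMap.id_apply, inner_sub_left,
    real_inner_smul_left, real_inner_self_eq_norm_sq]
  linarith

theorem coercive_shift_XX (h : WeaklyConvexConcave L ρ) (z : Pt n m) (x : Vec n) :
    (η - ρ) * ‖x‖ ^ 2 ≤ ⟪(η • ContinuousLinearMap.id ℝ (Vec n) + hessXX L z) x, x⟫_ℝ := by
  have := h.hessXX_ge z x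
  simp only [add_apply, smul_apply, ContinuousLinearMap.id_apply, inner_add_left,
    real_inner_smul_left, real_inner_self_eq_norm_sq]
  linarith

theorem DominantXAt.var (hL : TwiceDifferentiable L) (h : WeaklyConvexConcave L ρ)
    (hηρ : ρ < η) (hδ0 : 0 ≤ δ) (hδ : ∀ z, ‖hessXY L z‖ ≤ δ) {z : Pt n m}
    (hd : DominantXAt L η α z) : VarDominantX L η α (δ / (η - ρ)) z := by
  intro x
  obtain ⟨u, hu, hle⟩ := exists_le_of_smul_id_le_schur (sub_pos.2 hηρ) (hessXY_adjoint hL z)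
    (coercive_shift_YY h z) (norm_hessYX_le hL hδ0 hδ z) hd x
  refine ⟨u, hu, ?_⟩
  rw [inner_hess_pt hL]
  simp only [sub_apply, smul_apply, ContinuousLinearMap.id_apply, inner_sub_left,
    real_inner_smul_left, real_inner_self_eq_norm_sq] at hle
  linarith

theorem DominantYAt.var (hL : TwiceDifferentiable L) (h : WeaklyConvexConcave L ρ)
    (hηρ : ρ < η) (hδ : ∀ z, ‖hessXY L z‖ ≤ δ) {z : Pt n m}
    (hd : DominantYAt L η α z) : VarDominantY L η α (δ / (η - ρ)) z := by
  intro y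
  obtain ⟨v, hv, hle⟩ := exists_le_of_smul_id_le_schur (sub_pos.2 hηρ)
    (fun y v => hessYX_adjoint hL z v y) (coercive_shift_XX h z) (hδ z) hd y
  -- Negating the Hessian flips the sign of the mixed term, hence of the maximizer.
  refine ⟨-v, by rwa [norm_neg], ?_⟩
  rw [inner_hess_pt hL, norm_neg]
  simp only [add_apply, neg_apply, smul_apply, ContinuousLinearMap.id_apply, inner_add_left,
    real_inner_smul_left, real_inner_self_eq_norm_sq] at hle
  rw [hessYX_adjoint hL, real_inner_comm (hessXY L z y) v, inner_neg_left] at hle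
  simp only [map_neg, inner_neg_left, inner_neg_right, neg_neg]
  linarith

theorem abs_inner_le_of_opNorm_le {T : Pt n m →L[ℝ] Pt n m} {c : ℝ} (hT : ‖T‖ ≤ c) (v : Pt n m) :
    |⟪T v, v⟫_ℝ| ≤ c * ‖v‖ ^ 2 :=
  calc |⟪T v, v⟫_ℝ| ≤ ‖T v‖ * ‖v‖ := abs_real_inner_le_norm _ _
    _ ≤ c * ‖v‖ * ‖v‖ := by gcongr; exact T.le_of_opNorm_le hT v
    _ = c * ‖v‖ ^ 2 := by ring

/-- The same test vector u is kept: the loss c(‖x‖² + ‖u‖²) is at most c(1+κ²)‖x‖², which is why the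
definition records the bound on u. -/
theorem VarDominantX.perturb {κ c : ℝ} (hc : 0 ≤ c) {z w : Pt n m}
    (hd : VarDominantX L η α κ z) (hzw : ‖hess L w - hess L z‖ ≤ c) :
    VarDominantX L η (α - c * (1 + κ ^ 2)) κ w := by
  intro x
  obtain ⟨u, hu, hle⟩ := hd x
  refine ⟨u, hu, ?_⟩
  have h1 := (abs_le.1 (abs_inner_le_of_opNorm_le hzw (pt x u))).1
  rw [sub_apply, inner_sub_left, norm_sq_pt, pt_fst, pt_snd] at h1
  have h2 : ‖u‖ ^ 2 ≤ κ ^ 2 * ‖x‖ ^ 2 := by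
    rw [← mul_pow]; exact pow_le_pow_left₀ (norm_nonneg _) hu 2
  nlinarith [mul_le_mul_of_nonneg_left h2 hc]

theorem VarDominantY.perturb {κ c : ℝ} (hc : 0 ≤ c) {z w : Pt n m}
    (hd : VarDominantY L η α κ z) (hzw : ‖hess L w - hess L z‖ ≤ c) :
    VarDominantY L η (α - c * (1 + κ ^ 2)) κ w := by
  intro y
  obtain ⟨v, hv, hle⟩ := hd y
  refine ⟨v, hv, ?_⟩
  have h1 := (abs_le.1 (abs_inner_le_of_opNorm_le hzw (pt v y))).2
  rw [sub_apply, inner_sub_left, norm_sq_pt, pt_fst, pt_snd] at h1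
  have h2 : ‖v‖ ^ 2 ≤ κ ^ 2 * ‖y‖ ^ 2 := by
    rw [← mul_pow]; exact pow_le_pow_left₀ (norm_nonneg _) hv 2
  nlinarith [mul_le_mul_of_nonneg_left h2 hc]

/-- Dominance makes the resolvent of the saddle gradient field firmly contractive. -/
theorem inner_shiftJac_le {κ : ℝ} (hL : TwiceDifferentiable L) (h : WeaklyConvexConcave L ρ)
    (hηρ : ρ < η) (hηα : 0 < η + α) {z : Pt n m} (hx : VarDominantX L η α κ z)
    (hy : VarDominantY L η α κ z) (U : Pt n m) :
    ⟪U, shiftJac L η z U⟫_ℝ ≤ ‖shiftJac L η z U‖ ^ 2 / (η + α) := by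
  have hm : 0 < η - ρ := sub_pos.2 hηρ
  have hinv := isInvertible_of_coercive hm (inner_shiftJac_ge (η := η) hL h z)
  set W := shiftJac L η z U with hW
  -- Splitting the right-hand side by blocks: `a.fst` and `b.snd` are governed by the two Schur
  -- complements, and the cross terms cancel in `h3`.
  obtain ⟨a, ha⟩ : ∃ a, shiftJac L η z a = inX n m W.fst := ⟨_, apply_inverse_apply hinv _⟩
  obtain ⟨b, hb⟩ : ∃ b, shiftJac L η z b = inY n m W.snd := ⟨_, apply_inverse_apply hinv _⟩
  have hU : U = a + b := by
    obtain ⟨e, he⟩ := hinv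
    apply e.injective
    change (e : Pt n m →L[ℝ] Pt n m) U = (e : Pt n m →L[ℝ] Pt n m) (a + b)
    rw [he, map_add, ha, hb, inX_add_inY]
  have hfst : ∀ v, (shiftJac L η z v).fst =
      η • v.fst + hessXX L z v.fst + hessXY L z v.snd := fun v => by
    simp [shiftJac, jac_fst, add_assoc]
  have hsnd : ∀ v, (shiftJac L η z v).snd =
      η • v.snd + (-hessYY L z) v.snd + (-hessYX L z) v.fst := fun v => by
    simp only [shiftJac, add_apply, smul_apply, ContinuousLinearMap.id_apply, WithLp.add_snd,
      WithLp.smul_snd, jac_snd, neg_apply]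
    abel
  have ha1 := hfst a
  have ha2 := hsnd a
  have hb1 := hfst b
  have hb2 := hsnd b
  rw [ha] at ha1 ha2
  rw [hb] at hb1 hb2
  simp only [inX_fst, inX_snd, inY_fst, inY_snd] at ha1 ha2 hb1 hb2
  have hA := fun x => h.hessXX_ge z x
  have hC := fun x => h.hessYY_le z x
  have h1 : ⟪a.fst, W.fst⟫_ℝ ≤ ‖W.fst‖ ^ 2 / (η + α) := by
    refine inner_schur_le (A := hessXX L z) (B := hessXY L z) (B' := hessYX L z)
      (C := -hessYY L z) (u := a.snd) hηα (hessXY_adjoint hL z) (fun x y => ?_) (fun u => ?_)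
      (fun x => ?_) ?_ ha1.symm
    · simp [hessYY_symm hL]
    · have := hC u
      have h0 : 0 ≤ (η - ρ) * ‖u‖ ^ 2 := by positivity
      simp only [neg_apply, inner_neg_left]
      linarith
    · obtain ⟨u, -, hu⟩ := hx x
      refine ⟨u, ?_⟩
      rw [inner_hess_pt hL] at hu
      simp only [neg_apply, inner_neg_left]
      linarith
    · rw [neg_apply (hessYX L z)] at ha2
      exact (eq_of_sub_eq_zero (by rw [sub_eq_add_neg, ← ha2]))
  have h2 : ⟪b.snd, W.snd⟫_ℝ ≤ ‖W.snd‖ ^ 2 / (η + α) := by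
    refine inner_schur_le (A := -hessYY L z) (B := -hessYX L z) (B' := -hessXY L z)
      (C := hessXX L z) (u := b.fst) hηα (fun x u => ?_) (hessXX_symm hL z) (fun u => ?_)
      (fun y => ?_) ?_ hb2.symm
    · simp [hessYX_adjoint hL]
    · have := hA u
      have h0 : 0 ≤ (η - ρ) * ‖u‖ ^ 2 := by positivity
      linarith
    · obtain ⟨v, -, hv⟩ := hy y
      refine ⟨v, ?_⟩
      rw [inner_hess_pt hL, hessXY_adjoint hL, real_inner_comm (hessYX L z v) y] at hv
      simp only [neg_apply, inner_neg_left]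
      linarith
    · rw [neg_apply]
      exact eq_neg_of_add_eq_zero_left hb1.symm
  have h3 : ⟪a.snd, W.snd⟫_ℝ + ⟪b.fst, W.fst⟫_ℝ = 0 := by
    have e1 : ⟪a.snd, W.snd⟫_ℝ = ⟪η • a.snd + (-hessYY L z) a.snd, b.snd⟫_ℝ -
        ⟪hessXY L z a.snd, b.fst⟫_ℝ := by
      rw [hb2, hessXY_adjoint hL]
      simp only [inner_add_left, inner_add_right, neg_apply, inner_neg_left, inner_neg_right,
        real_inner_smul_left, real_inner_smul_right, hessYY_symm hL]
      ring
    have e2 : ⟪b.fst, W.fst⟫_ℝ = ⟪η • b.fst + hessXX L z b.fst, a.fst⟫_ℝ +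
        ⟪hessXY L z a.snd, b.fst⟫_ℝ := by
      rw [ha1]
      simp only [inner_add_left, inner_add_right,
        real_inner_smul_left, real_inner_smul_right, hessXX_symm hL]
      rw [real_inner_comm (hessXY L z a.snd)]
    have e3 : η • a.snd + (-hessYY L z) a.snd = hessYX L z a.fst := by
      rw [neg_apply (hessYX L z)] at ha2
      exact (eq_of_sub_eq_zero (by rw [sub_eq_add_neg, ← ha2]))
    have e4 : η • b.fst + hessXX L z b.fst = -hessXY L z b.snd :=
      eq_neg_of_add_eq_zero_left hb1.symm
    rw [e1, e2, e3, e4, hessYX_adjoint hL, inner_neg_left, real_inner_comm a.fst]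
    ring
  rw [inner_pt, hU, norm_sq_pt W, add_div]
  simp only [WithLp.add_fst, WithLp.add_snd, inner_add_left]
  linarith

/-- Dominance at the initial point. -/
theorem dominantXAt_of_lamMin (hL : TwiceDifferentiable L) (h : WeaklyConvexConcave L ρ)
    (hβ : ∀ z, ‖hess L z‖ ≤ β) (hη : 0 < η) (hηρ : ρ < η) (hβ0 : 0 ≤ β)
    (hξ : ∀ x y v, ‖hessXX L (pt x y) - hessXX L (pt x v)‖ ≤ ξ * ‖y - v‖)
    {x₀ : Vec n} {y₀ y' : Vec m}
    (hμ : μ • ContinuousLinearMap.id ℝ (Vec n) ≤ hessXX L (pt x₀ y'))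
    (hα : α ≤ μ + lamMin (hessXY L (pt x₀ y₀) ∘L hessYX L (pt x₀ y₀)) / (η + β) -
      ξ * ‖y₀ - y'‖) : DominantXAt L η α (pt x₀ y₀) := by
  have hA : (μ - ξ * ‖y₀ - y'‖) • ContinuousLinearMap.id ℝ (Vec n) ≤ hessXX L (pt x₀ y₀) := by
    refine smul_id_le_iff.2 ⟨hessXX_symm hL _, fun x => ?_⟩
    have h1 := (smul_id_le_iff.1 hμ).2 x
    have h2 : |⟪(hessXX L (pt x₀ y₀) - hessXX L (pt x₀ y')) x, x⟫_ℝ| ≤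
        ξ * ‖y₀ - y'‖ * ‖x‖ * ‖x‖ := (abs_real_inner_le_norm _ _).trans (by
      gcongr; exact ContinuousLinearMap.le_of_opNorm_le _ (hξ _ _ _) _)
    rw [sub_apply, inner_sub_left] at h2
    linarith [(abs_le.1 h2).1]
  have hQ : ∀ y, ⟪(η • ContinuousLinearMap.id ℝ (Vec m) - hessYY L (pt x₀ y₀)) y, y⟫_ℝ ≤
      (η + β) * ‖y‖ ^ 2 := fun y => by
    have h1 := (abs_le.1 (abs_inner_le_of_opNorm_le (hβ (pt x₀ y₀)) (inY n m y))).1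
    have h2 : ⟪hess L (pt x₀ y₀) (inY n m y), inY n m y⟫_ℝ = ⟪hessYY L (pt x₀ y₀) y, y⟫_ℝ := by
      simp [hessYY]
    rw [h2, norm_inY] at h1
    simp only [sub_apply, smul_apply, ContinuousLinearMap.id_apply, inner_sub_left,
      real_inner_smul_left, real_inner_self_eq_norm_sq]
    linarith
  refine le_trans ?_ (smul_id_le_schur (sub_pos.2 hηρ) (by linarith) hA (hessXY_adjoint hL _)
    (fun x y => ?_) (coercive_shift_YY h _) hQ)
  · refine smul_id_le_iff.2 ⟨fun x y => by simp [real_inner_smul_left, real_inner_smul_right],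
      fun x => ?_⟩
    simp only [smul_apply, ContinuousLinearMap.id_apply, real_inner_smul_left,
      real_inner_self_eq_norm_sq]
    gcongr
    linarith
  · simp [inner_sub_left, inner_sub_right, real_inner_smul_left, real_inner_smul_right,
      hessYY_symm hL]

theorem dominantYAt_of_lamMin (hL : TwiceDifferentiable L) (h : WeaklyConvexConcave L ρ)
    (hβ : ∀ z, ‖hess L z‖ ≤ β) (hη : 0 < η) (hηρ : ρ < η) (hβ0 : 0 ≤ β)
    (hξ : ∀ x u y, ‖hessYY L (pt x y) - hessYY L (pt u y)‖ ≤ ξ * ‖x - u‖)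
    {x₀ x' : Vec n} {y₀ : Vec m}
    (hμ : μ • ContinuousLinearMap.id ℝ (Vec m) ≤ -hessYY L (pt x' y₀))
    (hα : α ≤ μ + lamMin (hessYX L (pt x₀ y₀) ∘L hessXY L (pt x₀ y₀)) / (η + β) -
      ξ * ‖x₀ - x'‖) : DominantYAt L η α (pt x₀ y₀) := by
  have hA : (μ - ξ * ‖x₀ - x'‖) • ContinuousLinearMap.id ℝ (Vec m) ≤ -hessYY L (pt x₀ y₀) := by
    refine smul_id_le_iff.2 ⟨fun x y => by simp [hessYY_symm hL], fun x => ?_⟩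
    have h1 := (smul_id_le_iff.1 hμ).2 x
    have h2 : |⟪(hessYY L (pt x₀ y₀) - hessYY L (pt x' y₀)) x, x⟫_ℝ| ≤
        ξ * ‖x₀ - x'‖ * ‖x‖ * ‖x‖ := (abs_real_inner_le_norm _ _).trans (by
      gcongr; exact ContinuousLinearMap.le_of_opNorm_le _ (hξ _ _ _) _)
    rw [sub_apply, inner_sub_left] at h2
    rw [neg_apply, inner_neg_left] at h1 ⊢
    linarith [(abs_le.1 h2).2]
  have hQ : ∀ x, ⟪(η • ContinuousLinearMap.id ℝ (Vec n) + hessXX L (pt x₀ y₀)) x, x⟫_ℝ ≤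
      (η + β) * ‖x‖ ^ 2 := fun x => by
    have h1 := (abs_le.1 (abs_inner_le_of_opNorm_le (hβ (pt x₀ y₀)) (inX n m x))).2
    have h2 : ⟪hess L (pt x₀ y₀) (inX n m x), inX n m x⟫_ℝ = ⟪hessXX L (pt x₀ y₀) x, x⟫_ℝ := by
      simp [hessXX]
    rw [h2, norm_inX] at h1
    simp only [add_apply, smul_apply, ContinuousLinearMap.id_apply, inner_add_left,
      real_inner_smul_left, real_inner_self_eq_norm_sq]
    linarith
  refine le_trans ?_ (smul_id_le_schur (sub_pos.2 hηρ) (by linarith) hA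
    (fun y v => hessYX_adjoint hL _ v y) (fun x y => ?_) (coercive_shift_XX h _) hQ)
  · refine smul_id_le_iff.2 ⟨fun x y => by simp [real_inner_smul_left, real_inner_smul_right],
      fun x => ?_⟩
    simp only [smul_apply, ContinuousLinearMap.id_apply, real_inner_smul_left,
      real_inner_self_eq_norm_sq]
    gcongr
    linarith
  · simp [inner_add_left, inner_add_right, real_inner_smul_left, real_inner_smul_right,
      hessXX_symm hL]

end Dominance

/-! ### Contractions on a closed ball -/

section FixedPoint

variable {E : Type*} [NormedAddCommGroup E]

/-- Banach's fixed point theorem on a closed ball. -/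
theorem exists_fixedPoint_closedBall [CompleteSpace E] {T : E → E} {c : E} {q R : ℝ} (hq0 : 0 ≤ q)
    (hq1 : q < 1) (hR : 0 ≤ R)
    (hT : ∀ a ∈ Metric.closedBall c R, ∀ b ∈ Metric.closedBall c R,
      ‖T a - T b‖ ≤ q * ‖a - b‖) (hc : ‖T c - c‖ ≤ (1 - q) * R) :
    ∃ z ∈ Metric.closedBall c R, T z = z := by
  have hmem : c ∈ Metric.closedBall c R := Metric.mem_closedBall_self hR
  have hmaps : Set.MapsTo T (Metric.closedBall c R) (Metric.closedBall c R) := by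
    intro a ha
    have h1 := hT a ha c hmem
    rw [mem_closedBall_iff_norm] at ha ⊢
    calc ‖T a - c‖ ≤ ‖T a - T c‖ + ‖T c - c‖ := norm_sub_le_norm_sub_add_norm_sub _ _ _
      _ ≤ q * R + (1 - q) * R := add_le_add (h1.trans (by gcongr)) hc
      _ = R := by ring
  have hcon : ContractingWith q.toNNReal (hmaps.restrict T _ _) := by
    refine ⟨Real.toNNReal_lt_one.2 hq1, LipschitzWith.of_dist_le_mul fun a b => ?_⟩
    rw [Real.coe_toNNReal q hq0, Subtype.dist_eq, Subtype.dist_eq, dist_eq_norm, dist_eq_norm]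
    exact hT a a.2 b b.2
  obtain ⟨z, hz, hfix, -⟩ := hcon.exists_fixedPoint' Metric.isClosed_closedBall.isComplete hmaps
    hmem (edist_ne_top _ _)
  exact ⟨z, hz, hfix⟩

/-- The mean value inequality on a closed ball. -/
theorem norm_sub_le_of_hasFDerivAt_closedBall [NormedSpace ℝ E] {T : E → E} {c : E} {q R : ℝ}
    (hT : ∀ w ∈ Metric.closedBall c R, ∃ T' : E →L[ℝ] E, HasFDerivAt T T' w ∧ ‖T'‖ ≤ q)
    {a b : E} (ha : a ∈ Metric.closedBall c R) (hb : b ∈ Metric.closedBall c R) :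
    ‖T a - T b‖ ≤ q * ‖a - b‖ := by
  refine (convex_closedBall c R).norm_image_sub_le_of_norm_fderiv_le (𝕜 := ℝ)
    (fun w hw => ?_) (fun w hw => ?_) hb ha
  · obtain ⟨T', hT', -⟩ := hT w hw
    exact hT'.differentiableAt
  · obtain ⟨T', hT', hle⟩ := hT w hw
    rwa [hT'.fderiv]

end FixedPoint

/-! ### Lipschitz bound and derivative of the proximal map -/

section ProxMap

variable {L : Pt n m → ℝ} {ρ β η α lam κ : ℝ} {P : Pt n m → Pt n m}

theorem norm_prox_sub_self_le (hL : TwiceDifferentiable L) (h : WeaklyConvexConcave L ρ)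
    (hηρ : ρ < η) (hP : ∀ w, shift L η (P w) = η • w) (z : Pt n m) :
    ‖P z - z‖ ≤ ‖gradient L z‖ / (η - ρ) := by
  have h1 := norm_le_of_strongly_monotone (shift_strongly_monotone (η := η) hL h) z (P z)
  have e : shift L η z - shift L η (P z) = field L z := by rw [hP, shift]; abel
  rw [e, field, norm_reflect, norm_sub_rev] at h1
  rw [le_div_iff₀ (sub_pos.2 hηρ)]
  linarith

theorem norm_prox_sub_le (hL : TwiceDifferentiable L) (h : WeaklyConvexConcave L ρ)
    (hβ : ∀ z, ‖hess L z‖ ≤ β) (hηρ : ρ < η) (hP : ∀ w, shift L η (P w) = η • w)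
    (a b : Pt n m) : ‖P a - P b‖ ≤ (1 + β / (η - ρ)) * ‖a - b‖ := by
  -- With this comparison point the η terms cancel and only a difference of `field` over the
  -- displacement a - b remains. This yields the factor 1 + β/(η-ρ) that the smallness condition on
  -- δ contains.
  set s := P b + (a - b) with hs
  have h1 := norm_le_of_strongly_monotone (shift_strongly_monotone (η := η) hL h) (P a) s
  have e : shift L η (P a) - shift L η s = field L (P b) - field L s := by
    have h2 : field L (P b) = η • b - η • P b := eq_sub_of_add_eq' (hP b)
    rw [hP, h2, shift, hs]
    module
  have h3 := norm_field_sub_le hL hβ (P b) s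
  have e2 : P b - s = -(a - b) := by rw [hs]; abel
  rw [e2, norm_neg] at h3
  rw [e] at h1
  have h4 : ‖P a - s‖ ≤ β / (η - ρ) * ‖a - b‖ := by
    rw [div_mul_eq_mul_div, le_div_iff₀ (sub_pos.2 hηρ)]
    linarith
  have e3 : s - P b = a - b := by rw [hs]; abel
  calc ‖P a - P b‖ ≤ ‖P a - s‖ + ‖s - P b‖ := norm_sub_le_norm_sub_add_norm_sub _ _ _
    _ ≤ β / (η - ρ) * ‖a - b‖ + ‖a - b‖ := by rw [e3]; gcongr
    _ = _ := by ring

theorem continuous_prox (hL : TwiceDifferentiable L) (h : WeaklyConvexConcave L ρ)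
    (hβ : ∀ z, ‖hess L z‖ ≤ β) (hηρ : ρ < η) (hP : ∀ w, shift L η (P w) = η • w) :
    Continuous P := by
  refine (LipschitzWith.of_dist_le' (K := 1 + β / (η - ρ)) fun a b => ?_).continuous
  rw [dist_eq_norm, dist_eq_norm]
  exact norm_prox_sub_le hL h hβ hηρ hP a b

/-- Up to scaling, `P` is a continuous inverse of `shift`, whose derivative is invertible. -/
theorem exists_hasFDerivAt_prox (hL : TwiceDifferentiable L) (h : WeaklyConvexConcave L ρ)
    (hβ : ∀ z, ‖hess L z‖ ≤ β) (hη : 0 < η) (hηρ : ρ < η)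
    (hP : ∀ w, shift L η (P w) = η • w) (w : Pt n m) :
    ∃ P' : Pt n m →L[ℝ] Pt n m, HasFDerivAt P P' w ∧
      ∀ v, shiftJac L η (P w) (P' v) = η • v := by
  obtain ⟨e, he⟩ := isInvertible_of_coercive (sub_pos.2 hηρ)
    (inner_shiftJac_ge (η := η) hL h (P w))
  have hg : ContinuousAt (fun x => P (η⁻¹ • x)) (η • w) :=
    ((continuous_prox hL h hβ hηρ hP).comp (continuous_const_smul η⁻¹)).continuousAt
  have e1 : η⁻¹ • η • w = w := inv_smul_smul₀ hη.ne' w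
  have hd : HasFDerivAt (shift L η) (e : Pt n m →L[ℝ] Pt n m) (P (η⁻¹ • η • w)) := by
    rw [e1, he]; exact hasFDerivAt_shift hL η _
  have h1 := HasFDerivAt.of_local_left_inverse hg hd
    (Filter.Eventually.of_forall fun y => by rw [hP, smul_inv_smul₀ hη.ne'])
  have h2 : HasFDerivAt (fun x : Pt n m => η • x) (η • ContinuousLinearMap.id ℝ (Pt n m)) w :=
    (hasFDerivAt_id w).const_smul η
  have h3 := h1.comp w h2
  refine ⟨_, h3.congr_of_eventuallyEq (Filter.Eventually.of_forall fun x => ?_), fun v => ?_⟩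
  · simp [inv_smul_smul₀ hη.ne']
  · rw [← he]
    simp

/-- For ρ = 0 the convention η/0 = 0 makes the minimum 1, as intended. -/
theorem min_ratio_pos (hηρ : ρ < η) : 0 < min 1 ((η / ρ - 1) ^ 2) := by
  have hne : η / ρ - 1 ≠ 0 := by
    rcases eq_or_ne ρ 0 with h | h
    · simp [h]
    · rw [sub_ne_zero, Ne, div_eq_one_iff_eq h]
      exact hηρ.ne'
  exact lt_min one_pos (by positivity)

/-- The derivative of the damped proximal step at a point where dominance holds. -/
theorem norm_damped_apply_sq_le (hL : TwiceDifferentiable L) (h : WeaklyConvexConcave L ρ)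
    (hη : 0 < η) (hηρ : ρ < η) (hα : 0 < α) (hlam : 0 ≤ lam) {z : Pt n m}
    (hx : VarDominantX L η α κ z) (hy : VarDominantY L η α κ z) {u v : Pt n m}
    (hu : shiftJac L η z u = v) :
    ‖v - lam • (v - η • u)‖ ^ 2 ≤
      (1 - 2 * lam / (η / α + 1) + lam ^ 2 / min 1 ((η / ρ - 1) ^ 2)) * ‖v‖ ^ 2 := by
  have h1 := inner_shiftJac_ge (η := η) hL h z u
  rw [hu] at h1
  have h2 := norm_sub_resolvent_sq_le hη hηρ h1
  have hηα : 0 < η + α := by linarith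
  have h3 := inner_shiftJac_le hL h hηρ hηα hx hy u
  rw [hu, real_inner_comm] at h3
  rw [← le_div_iff₀ (min_ratio_pos hηρ)] at h2
  have h4 : ‖v‖ ^ 2 / (η / α + 1) ≤ ⟪v, v - η • u⟫_ℝ := by
    rw [inner_sub_right, real_inner_smul_right, real_inner_self_eq_norm_sq]
    have h5 : ‖v‖ ^ 2 / (η / α + 1) = ‖v‖ ^ 2 - η * (‖v‖ ^ 2 / (η + α)) := by
      field_simp
      ring
    rw [h5]
    linarith [mul_le_mul_of_nonneg_left h3 hη.le]
  rw [norm_sub_sq_real, real_inner_smul_right, norm_smul, mul_pow, Real.norm_of_nonneg hlam]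
  generalize min 1 ((η / ρ - 1) ^ 2) = M at h2 ⊢
  have h5 := mul_le_mul_of_nonneg_left h4 hlam
  have h6 := mul_le_mul_of_nonneg_left h2 (sq_nonneg lam)
  have e : (1 - 2 * lam / (η / α + 1) + lam ^ 2 / M) * ‖v‖ ^ 2 =
      ‖v‖ ^ 2 - 2 * (lam * (‖v‖ ^ 2 / (η / α + 1))) + lam ^ 2 * (‖v‖ ^ 2 / M) := by ring
  rw [e]
  linarith

theorem exists_hasFDerivAt_damped (hL : TwiceDifferentiable L) (h : WeaklyConvexConcave L ρ)
    (hβ : ∀ z, ‖hess L z‖ ≤ β) (hη : 0 < η) (hηρ : ρ < η)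
    (hP : ∀ w, shift L η (P w) = η • w) (hα : 0 < α) (hlam : 0 ≤ lam) {w : Pt n m}
    (hx : VarDominantX L η α κ (P w)) (hy : VarDominantY L η α κ (P w)) :
    ∃ T' : Pt n m →L[ℝ] Pt n m, HasFDerivAt (fun w => (1 - lam) • w + lam • P w) T' w ∧
      ‖T'‖ ≤ √(1 - 2 * lam / (η / α + 1) + lam ^ 2 / min 1 ((η / ρ - 1) ^ 2)) := by
  obtain ⟨P', hP', hJ⟩ := exists_hasFDerivAt_prox hL h hβ hη hηρ hP w
  have h1 : HasFDerivAt (fun w : Pt n m => (1 - lam) • w)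
      ((1 - lam) • ContinuousLinearMap.id ℝ (Pt n m)) w :=
    ((1 - lam) • ContinuousLinearMap.id ℝ (Pt n m)).hasFDerivAt
  have h2 : HasFDerivAt (fun w => lam • P w) (lam • P') w := hP'.const_smul lam
  refine ⟨_, h1.fun_add h2, ContinuousLinearMap.opNorm_le_bound _ (Real.sqrt_nonneg _) fun v => ?_⟩
  have hv := norm_damped_apply_sq_le hL h hη hηρ hα hlam hx hy (u := η⁻¹ • P' v) (v := v)
    (by rw [map_smul, hJ, inv_smul_smul₀ hη.ne'])
  have e : ((1 - lam) • ContinuousLinearMap.id ℝ (Pt n m) + lam • P') v =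
      v - lam • (v - η • η⁻¹ • P' v) := by
    rw [smul_inv_smul₀ hη.ne', add_apply, smul_apply, smul_apply, ContinuousLinearMap.id_apply]
    module
  rw [e]
  have h3 := Real.le_sqrt_of_sq_le hv
  rwa [Real.sqrt_mul' _ (sq_nonneg _), Real.sqrt_sq (norm_nonneg v)] at h3

/-- The damped proximal step contracts where interaction dominance holds. -/
theorem norm_damped_sub_le (hL : TwiceDifferentiable L) (h : WeaklyConvexConcave L ρ)
    (hβ : ∀ z, ‖hess L z‖ ≤ β) (hη : 0 < η) (hηρ : ρ < η)
    (hP : ∀ w, shift L η (P w) = η • w) (hα : 0 < α) (hlam : 0 ≤ lam) {z₀ : Pt n m} {R : ℝ}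
    (hdom : ∀ w ∈ Metric.closedBall z₀ R,
      VarDominantX L η α κ (P w) ∧ VarDominantY L η α κ (P w)) {a b : Pt n m}
    (ha : a ∈ Metric.closedBall z₀ R) (hb : b ∈ Metric.closedBall z₀ R) :
    ‖((1 - lam) • a + lam • P a) - ((1 - lam) • b + lam • P b)‖ ≤
      √(1 - 2 * lam / (η / α + 1) + lam ^ 2 / min 1 ((η / ρ - 1) ^ 2)) * ‖a - b‖ :=
  norm_sub_le_of_hasFDerivAt_closedBall (T := fun w => (1 - lam) • w + lam • P w)
    (fun w hw => exists_hasFDerivAt_damped hL h hβ hη hηρ hP hα hlam (hdom w hw).1 (hdom w hw).2)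
    ha hb

end ProxMap

/-! ### The initial point and the smallness of δ -/

section Initialization

variable {L : Pt n m → ℝ} {δ : ℝ}

theorem gradient_fst_eq_zero (hL : TwiceDifferentiable L) {x : Vec n} {y : Vec m}
    (hx : IsLocalMin (fun u => L (pt u y)) x) : (gradient L (pt x y)).fst = 0 := by
  have h1 := hx.hasFDerivAt_eq_zero
    ((hL.1 (pt x y)).hasFDerivAt.comp x (hasFDerivAt_pt_left x y))
  refine ext_inner_right ℝ fun a => ?_
  have h2 := inner_gradient_eq hL (pt x y) (inX n m a)
  have h3 : fderiv ℝ L (pt x y) (inX n m a) = 0 := DFunLike.congr_fun h1 a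
  rw [h3, inner_pt] at h2
  simpa using h2

theorem gradient_snd_eq_zero (hL : TwiceDifferentiable L) {x : Vec n} {y : Vec m}
    (hy : IsLocalMax (fun v => L (pt x v)) y) : (gradient L (pt x y)).snd = 0 := by
  have h1 := hy.hasFDerivAt_eq_zero
    ((hL.1 (pt x y)).hasFDerivAt.comp y (hasFDerivAt_pt_right x y))
  refine ext_inner_right ℝ fun a => ?_
  have h2 := inner_gradient_eq hL (pt x y) (inY n m a)
  have h3 : fderiv ℝ L (pt x y) (inY n m a) = 0 := DFunLike.congr_fun h1 a
  rw [h3, inner_pt] at h2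
  simpa using h2

/-- The gradient at the initial point is controlled by the interaction. -/
theorem norm_gradient_le (hL : TwiceDifferentiable L) (hδ0 : 0 ≤ δ)
    (hδ : ∀ z, ‖hessXY L z‖ ≤ δ) {x₀ x' : Vec n} {y₀ y' : Vec m}
    (hx₀ : IsLocalMin (fun u => L (pt u y')) x₀) (hy₀ : IsLocalMax (fun v => L (pt x' v)) y₀) :
    ‖gradient L (pt x₀ y₀)‖ ≤ δ * ‖pt x₀ y₀ - pt x' y'‖ := by
  -- This component vanishes at (x₀, y'), and its derivative in y is the mixed block.
  have h1 : ‖(gradient L (pt x₀ y₀)).fst‖ ≤ δ * ‖y₀ - y'‖ := by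
    have hd : ∀ v ∈ (Set.univ : Set (Vec m)), HasFDerivWithinAt
        (fun v => (gradient L (pt x₀ v)).fst) (hessXY L (pt x₀ v)) Set.univ v := fun v _ =>
      ((prX n m).hasFDerivAt.comp v
        ((hL.2 (pt x₀ v)).hasFDerivAt.comp v (hasFDerivAt_pt_right x₀ v))).hasFDerivWithinAt
    have := convex_univ.norm_image_sub_le_of_norm_hasFDerivWithin_le hd (fun v _ => hδ _)
      (Set.mem_univ y') (Set.mem_univ y₀)
    rwa [gradient_fst_eq_zero hL hx₀, sub_zero] at this
  have h2 : ‖(gradient L (pt x₀ y₀)).snd‖ ≤ δ * ‖x₀ - x'‖ := by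
    have hd : ∀ u ∈ (Set.univ : Set (Vec n)), HasFDerivWithinAt
        (fun u => (gradient L (pt u y₀)).snd) (hessYX L (pt u y₀)) Set.univ u := fun u _ => by
      have h3 : HasFDerivAt (fun u => gradient L (pt u y₀)) (hess L (pt u y₀) ∘L inX n m) u :=
        HasFDerivAt.comp u (g := gradient L) (hL.2 (pt u y₀)).hasFDerivAt
          (hasFDerivAt_pt_left u y₀)
      exact ((prY n m).hasFDerivAt.comp u h3).hasFDerivWithinAt
    have := convex_univ.norm_image_sub_le_of_norm_hasFDerivWithin_le hd
      (fun u _ => norm_hessYX_le hL hδ0 hδ _) (Set.mem_univ x') (Set.mem_univ x₀)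
    rwa [gradient_snd_eq_zero hL hy₀, sub_zero] at this
  refine le_of_sq_le_sq ?_ (by positivity)
  rw [mul_pow, norm_sq_pt, norm_sq_pt (pt x₀ y₀ - pt x' y')]
  have h3 := pow_le_pow_left₀ (norm_nonneg _) h1 2
  have h4 := pow_le_pow_left₀ (norm_nonneg _) h2 2
  simp only [WithLp.sub_fst, WithLp.sub_snd, pt_fst, pt_snd]
  rw [mul_pow] at h3 h4
  linarith

/-- Dominance degrades by less than half on the region visited by the iteration. -/
theorem dominance_loss_lt {α η β H δ ρ a D : ℝ} (hα : 0 < α) (hη : 0 < η) (hηρ : ρ < η)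
    (hβ : 0 ≤ β) (hH : 0 ≤ H) (hδ : 0 ≤ δ) (ha0 : 0 ≤ a) (ha : a * (η - ρ) ≤ δ * D)
    (hsmall : δ * D * (2 * (1 + 4 * √2 * (η + α / 2) / α +
        4 * √2 * β * (η + α / 2) / (α * (η - ρ))) *
      H * (1 + 2 * δ / (η - ρ) + δ ^ 2 / (η - ρ) ^ 2)) ≤ α * (η - ρ)) :
    H * (a * (1 + 2 * (2 * (η + α / 2) / α) * (1 + β / (η - ρ)))) *
      (1 + (δ / (η - ρ)) ^ 2) < α / 2 := by
  have hm : 0 < η - ρ := sub_pos.2 hηρ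
  set c := 2 * (η + α / 2) / α with hc
  have hc0 : 0 < c := by positivity
  set b := β / (η - ρ) with hb
  have hb0 : 0 ≤ b := by positivity
  set k := δ / (η - ρ) with hk
  have hk0 : 0 ≤ k := by positivity
  have e1 : 1 + 4 * √2 * (η + α / 2) / α + 4 * √2 * β * (η + α / 2) / (α * (η - ρ)) =
      1 + 2 * √2 * c * (1 + b) := by
    rw [hc, hb]; field_simp; ring
  have e2 : 1 + 2 * δ / (η - ρ) + δ ^ 2 / (η - ρ) ^ 2 = 1 + 2 * k + k ^ 2 := by
    rw [hk, div_pow]; ring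
  rw [e1, e2] at hsmall
  have h1 : H * (a * (1 + 2 * √2 * c * (1 + b))) * (1 + 2 * k + k ^ 2) ≤ α / 2 := by
    have : a * (η - ρ) * (2 * (1 + 2 * √2 * c * (1 + b)) * H * (1 + 2 * k + k ^ 2)) ≤
        α * (η - ρ) := le_trans (by gcongr) hsmall
    refine le_of_mul_le_mul_right ?_ (by positivity : 0 < 2 * (η - ρ))
    linarith
  -- Strictness comes from 1 < √2, which requires Ha > 0; if Ha = 0 nothing is lost.
  rcases (mul_nonneg hH ha0).eq_or_lt with h0 | h0
  · rw [← mul_assoc, ← h0]; simpa using hα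
  have hs : 1 < √2 := by
    rw [Real.lt_sqrt zero_le_one]; norm_num
  calc H * (a * (1 + 2 * c * (1 + b))) * (1 + k ^ 2)
      = H * a * ((1 + 2 * 1 * c * (1 + b)) * (1 + 0 + k ^ 2)) := by ring
    _ < H * a * ((1 + 2 * √2 * c * (1 + b)) * (1 + 0 + k ^ 2)) := by gcongr
    _ ≤ H * a * ((1 + 2 * √2 * c * (1 + b)) * (1 + 2 * k + k ^ 2)) := by gcongr; linarith
    _ = H * (a * (1 + 2 * √2 * c * (1 + b))) * (1 + 2 * k + k ^ 2) := by ring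
    _ ≤ α / 2 := h1

end Initialization

/-! ### Fixed point and linear convergence -/

section Convergence

variable {L : Pt n m → ℝ} {ρ β η α₁ c g κ : ℝ} {P : Pt n m → Pt n m} {z₀ : Pt n m}

/-- A fixed point of the proximal map near a point where the residual is small. -/
theorem exists_prox_fixedPoint (hL : TwiceDifferentiable L) (h : WeaklyConvexConcave L ρ)
    (hβ : ∀ z, ‖hess L z‖ ≤ β) (hη : 0 < η) (hηρ : ρ < η)
    (hP : ∀ w, shift L η (P w) = η • w) (hα₁ : 0 < α₁) (hg : 0 ≤ g)
    (hc : η / α₁ + 1 < c) (hPz : ‖P z₀ - z₀‖ ≤ g)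
    (hdom : ∀ w ∈ Metric.closedBall z₀ (c * g),
      VarDominantX L η α₁ κ (P w) ∧ VarDominantY L η α₁ κ (P w)) :
    ∃ z ∈ Metric.closedBall z₀ (c * g), P z = z := by
  have hmin := min_ratio_pos hηρ
  set M := min 1 ((η / ρ - 1) ^ 2) with hM
  set c₁ := η / α₁ + 1 with hc₁
  have hc₁1 : 1 < c₁ := by rw [hc₁]; linarith [div_pos hη hα₁]
  have hc0 : 0 < c := by linarith
  have hdiff : 0 < 1 / c₁ - 1 / c := sub_pos.2 (one_div_lt_one_div_of_lt (by linarith) hc)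
  -- An auxiliary damping, unrelated to that of the method since fixed points do not depend on it.
  -- It makes the squared factor at most 1 - 2λ/c ≤ (1 - λ/c)², and as the first step has length at
  -- most λg, radius cg suffices.
  set lam := min 1 (2 * (1 / c₁ - 1 / c) * M) with hlam
  have hlam0 : 0 < lam := lt_min one_pos (by positivity)
  have hlam1 : lam ≤ 1 := min_le_left _ _
  have hlam2 : lam / M ≤ 2 * (1 / c₁ - 1 / c) := by
    rw [div_le_iff₀ hmin]; exact min_le_right _ _
  have hq0 : 0 ≤ 1 - lam / c := by
    rw [sub_nonneg, div_le_one hc0]; linarith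
  have hq1 : 1 - lam / c < 1 := by linarith [div_pos hlam0 hc0]
  have hsqrt : √(1 - 2 * lam / c₁ + lam ^ 2 / M) ≤ 1 - lam / c := by
    rw [Real.sqrt_le_left hq0]
    have h1 : lam ^ 2 / M ≤ lam * (2 * (1 / c₁ - 1 / c)) := by
      rw [pow_two, mul_div_assoc]; gcongr
    have h2 : lam * (2 * (1 / c₁ - 1 / c)) = 2 * lam / c₁ - 2 * (lam / c) := by ring
    nlinarith [sq_nonneg (lam / c)]
  obtain ⟨z, hz, hfix⟩ := exists_fixedPoint_closedBall
    (T := fun w => (1 - lam) • w + lam • P w) hq0 hq1 (by positivity : 0 ≤ c * g)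
    (fun a ha b hb => (norm_damped_sub_le hL h hβ hη hηρ hP hα₁ hlam0.le
      hdom ha hb).trans (by gcongr)) (by
        have e : (1 - lam) • z₀ + lam • P z₀ - z₀ = lam • (P z₀ - z₀) := by module
        rw [e, norm_smul, Real.norm_of_nonneg hlam0.le]
        calc lam * ‖P z₀ - z₀‖ ≤ lam * g := by gcongr
          _ = (1 - (1 - lam / c)) * (c * g) := by field_simp; ring)
  refine ⟨z, hz, ?_⟩
  have e : lam • (P z - z) = (1 - lam) • z + lam • P z - z := by module
  rw [hfix, sub_self] at e
  exact sub_eq_zero.1 ((smul_eq_zero.1 e).resolve_left hlam0.ne')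

theorem gradient_eq_zero_of_prox_eq (hP : ∀ w, shift L η (P w) = η • w) {z : Pt n m}
    (hz : P z = z) : gradient L z = 0 := by
  have h1 := hP z
  rw [hz, shift, add_eq_left, field] at h1
  rw [← norm_eq_zero, ← norm_reflect, h1, norm_zero]

theorem damped_convergence {lam : ℝ} (hL : TwiceDifferentiable L) (h : WeaklyConvexConcave L ρ)
    (hβ : ∀ z, ‖hess L z‖ ≤ β) (hη : 0 < η) (hηρ : ρ < η)
    (hP : ∀ w, shift L η (P w) = η • w) (hα₁ : 0 < α₁) (hg : 0 ≤ g)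
    (hc : η / α₁ + 1 < c) (hPz : ‖P z₀ - z₀‖ ≤ g)
    (hdom : ∀ w ∈ Metric.closedBall z₀ (2 * (c * g)),
      VarDominantX L η α₁ κ (P w) ∧ VarDominantY L η α₁ κ (P w))
    (hlam0 : 0 < lam) (hlam : lam ≤ 2 * (min 1 ((η / ρ - 1) ^ 2) / c))
    {z : ℕ → Pt n m} (hz0 : z 0 = z₀) (hstep : ∀ k, z (k + 1) = (1 - lam) • z k + lam • P (z k)) :
    ∃ zs : Pt n m, gradient L zs = 0 ∧ ‖zs - z₀‖ ≤ c * g ∧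
      (∃ q : ℝ, 0 ≤ q ∧ q < 1 ∧ ∀ k, ‖z k - zs‖ ≤ q ^ k * ‖z 0 - zs‖) ∧
      ∀ k, ‖z k - zs‖ ^ 2 ≤
        (1 - 2 * lam / c + lam ^ 2 / min 1 ((η / ρ - 1) ^ 2)) ^ k * ‖z 0 - zs‖ ^ 2 := by
  have hc₁1 : 1 < η / α₁ + 1 := by linarith [div_pos hη hα₁]
  have hc0 : 0 < c := by linarith
  have hcg : 0 ≤ c * g := by positivity
  have hsub : Metric.closedBall z₀ (c * g) ⊆ Metric.closedBall z₀ (2 * (c * g)) :=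
    Metric.closedBall_subset_closedBall (by linarith)
  obtain ⟨zs, hzs, hfix⟩ := exists_prox_fixedPoint hL h hβ hη hηρ hP hα₁ hg hc hPz
    fun w hw => hdom w (hsub hw)
  have hzs' := mem_closedBall_iff_norm.1 hzs
  have hcontr : ∀ w ∈ Metric.closedBall z₀ (2 * (c * g)), ‖((1 - lam) • w + lam • P w) - zs‖ ≤
      √(1 - 2 * lam / (η / α₁ + 1) + lam ^ 2 / min 1 ((η / ρ - 1) ^ 2)) * ‖w - zs‖ := by
    intro w hw
    have h1 := norm_damped_sub_le hL h hβ hη hηρ hP hα₁ hlam0.le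
      hdom hw (hsub hzs)
    have e : (1 - lam) • zs + lam • P zs = zs := by rw [hfix]; module
    rwa [e] at h1
  refine ⟨zs, gradient_eq_zero_of_prox_eq hP hfix, hzs', ?_⟩
  have hmin := min_ratio_pos hηρ
  have hmin1 : min 1 ((η / ρ - 1) ^ 2) ≤ 1 := min_le_left _ _
  generalize min 1 ((η / ρ - 1) ^ 2) = M at *
  generalize η / α₁ + 1 = c₁ at *
  have hc₁0 : 0 < c₁ := by linarith
  have hdiv : 2 * lam / c < 2 * lam / c₁ := by gcongr
  have hle1 : lam ^ 2 / M ≤ 2 * lam / c := by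
    rw [div_le_div_iff₀ hmin hc0]
    have h2 : lam * c ≤ 2 * M := by
      have := mul_le_mul_of_nonneg_right hlam hc0.le
      rwa [mul_assoc, div_mul_cancel₀ _ hc0.ne'] at this
    nlinarith
  -- Since M ≤ 1 ≤ c₁, the expression is at least (1 - λ/c₁)².
  have hnn : 0 ≤ 1 - 2 * lam / c₁ + lam ^ 2 / M := by
    have h1 : (lam / c₁) ^ 2 ≤ lam ^ 2 := by
      gcongr
      exact div_le_self hlam0.le hc₁1.le
    have h2 : lam ^ 2 ≤ lam ^ 2 / M := le_div_self (sq_nonneg _) hmin hmin1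
    have h3 : 2 * lam / c₁ = 2 * (lam / c₁) := by ring
    nlinarith [sq_nonneg (1 - lam / c₁)]
  have hq1 : √(1 - 2 * lam / c₁ + lam ^ 2 / M) < 1 := by
    rw [Real.sqrt_lt' one_pos]; linarith
  have hsq := Real.sq_sqrt hnn
  have hq0 := Real.sqrt_nonneg (1 - 2 * lam / c₁ + lam ^ 2 / M)
  generalize √(1 - 2 * lam / c₁ + lam ^ 2 / M) = q at *
  have hlin : ∀ k, ‖z k - zs‖ ≤ q ^ k * ‖z 0 - zs‖ := by
    intro k
    induction k with
    | zero => simp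
    | succ k ih =>
      -- Both z₀ and z k lie within cg of the fixed point; hence the doubled radius.
      have hmem : z k ∈ Metric.closedBall z₀ (2 * (c * g)) := by
        rw [mem_closedBall_iff_norm]
        have h1 : q ^ k * ‖z 0 - zs‖ ≤ ‖z 0 - zs‖ :=
          mul_le_of_le_one_left (norm_nonneg _) (pow_le_one₀ hq0 hq1.le)
        have h2 : ‖z 0 - zs‖ = ‖zs - z₀‖ := by rw [hz0, norm_sub_rev]
        have h3 := norm_sub_le_norm_sub_add_norm_sub (z k) zs z₀
        linarith
      calc ‖z (k + 1) - zs‖ ≤ q * ‖z k - zs‖ := by rw [hstep]; exact hcontr _ hmem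
        _ ≤ q * (q ^ k * ‖z 0 - zs‖) := by gcongr
        _ = q ^ (k + 1) * ‖z 0 - zs‖ := by ring
  refine ⟨⟨q, hq0, hq1, hlin⟩, fun k => ?_⟩
  calc ‖z k - zs‖ ^ 2 ≤ (q ^ k * ‖z 0 - zs‖) ^ 2 := pow_le_pow_left₀ (norm_nonneg _) (hlin k) 2
    _ = (q ^ 2) ^ k * ‖z 0 - zs‖ ^ 2 := by ring
    _ ≤ (1 - 2 * lam / c + lam ^ 2 / M) ^ k * ‖z 0 - zs‖ ^ 2 := by
      rw [hsq]
      gcongr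

end Convergence

end SaddlePPM

end

/-! ### Assembling the constants -/

theorem theorem4p1 (n m : ℕ) (L : SaddlePPM.Pt n m → ℝ) (ρ β H δ ξ η μ : ℝ)
    (x₀ x' : SaddlePPM.Vec n) (y₀ y' : SaddlePPM.Vec m)
    (hL : SaddlePPM.TwiceDifferentiable L)
    (hweak : SaddlePPM.WeaklyConvexConcave L ρ)
    (hβ0 : 0 ≤ β) (hH0 : 0 ≤ H) (hδ0 : 0 ≤ δ) (hξ0 : 0 ≤ ξ)
    (hβ : ∀ z, ‖SaddlePPM.hess L z‖ ≤ β)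
    (hH : ∀ z w, ‖SaddlePPM.hess L z - SaddlePPM.hess L w‖ ≤ H * ‖z - w‖)
    (hδ : ∀ z, ‖SaddlePPM.hessXY L z‖ ≤ δ)
    (hξx : ∀ x y v, ‖SaddlePPM.hessXX L (SaddlePPM.pt x y) -
      SaddlePPM.hessXX L (SaddlePPM.pt x v)‖ ≤ ξ * ‖y - v‖)
    (hξy : ∀ x u y, ‖SaddlePPM.hessYY L (SaddlePPM.pt x y) -
      SaddlePPM.hessYY L (SaddlePPM.pt u y)‖ ≤ ξ * ‖x - u‖)
    (hη0 : 0 < η) (hηρ : ρ < η)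
    -- the initialization
    (hx₀ : IsLocalMin (fun u => L (SaddlePPM.pt u y')) x₀)
    (hy₀ : IsLocalMax (fun v => L (SaddlePPM.pt x' v)) y₀)
    -- the curvature `μ` of the two subproblems at their local optima
    (hμ0 : 0 ≤ μ)
    (hμx : μ • ContinuousLinearMap.id ℝ (SaddlePPM.Vec n) ≤
      SaddlePPM.hessXX L (SaddlePPM.pt x₀ y'))
    (hμy : μ • ContinuousLinearMap.id ℝ (SaddlePPM.Vec m) ≤
      -SaddlePPM.hessYY L (SaddlePPM.pt x' y₀))
    -- `ξ` is small
    (hpsdx : ξ * ‖y₀ - y'‖ < μ + SaddlePPM.lamMin (SaddlePPM.hessXY L (SaddlePPM.pt x₀ y₀) ∘L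
      SaddlePPM.hessYX L (SaddlePPM.pt x₀ y₀)) / (η + β))
    (hpsdy : ξ * ‖x₀ - x'‖ < μ + SaddlePPM.lamMin (SaddlePPM.hessYX L (SaddlePPM.pt x₀ y₀) ∘L
      SaddlePPM.hessXY L (SaddlePPM.pt x₀ y₀)) / (η + β)) :
    -- the proximal step is well defined everywhere
    (∀ w, ∃! p, SaddlePPM.IsProx L η w p) ∧
    -- interaction dominance holds at the initial point with an explicit positive coefficient
    (∃ α, α = min
        (μ + SaddlePPM.lamMin (SaddlePPM.hessXY L (SaddlePPM.pt x₀ y₀) ∘L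
          SaddlePPM.hessYX L (SaddlePPM.pt x₀ y₀)) / (η + β) - ξ * ‖y₀ - y'‖)
        (μ + SaddlePPM.lamMin (SaddlePPM.hessYX L (SaddlePPM.pt x₀ y₀) ∘L
          SaddlePPM.hessXY L (SaddlePPM.pt x₀ y₀)) / (η + β) - ξ * ‖x₀ - x'‖) ∧
      0 < α ∧ SaddlePPM.DominantXAt L η α (SaddlePPM.pt x₀ y₀) ∧
      SaddlePPM.DominantYAt L η α (SaddlePPM.pt x₀ y₀)) ∧
    -- convergence, with any positive interaction dominance coefficient `α₀` at the initial point
    (∀ α₀ : ℝ, 0 < α₀ →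
      SaddlePPM.DominantXAt L η α₀ (SaddlePPM.pt x₀ y₀) →
      SaddlePPM.DominantYAt L η α₀ (SaddlePPM.pt x₀ y₀) →
      -- `δ` is small; the denominator (which vanishes if `H = 0`) is multiplied out
      δ * ‖SaddlePPM.pt x₀ y₀ - SaddlePPM.pt x' y'‖ *
          (2 * (1 + 4 * √2 * (η + α₀ / 2) / α₀ +
              4 * √2 * β * (η + α₀ / 2) / (α₀ * (η - ρ))) *
            H * (1 + 2 * δ / (η - ρ) + δ ^ 2 / (η - ρ) ^ 2)) ≤ α₀ * (η - ρ) →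
      ∀ lam : ℝ, 0 < lam → lam ≤ 1 →
      lam ≤ 2 * (min 1 ((η / ρ - 1) ^ 2) / (2 * η / α₀ + 1)) →
      ∀ z : ℕ → SaddlePPM.Pt n m, z 0 = SaddlePPM.pt x₀ y₀ → SaddlePPM.IsDampedPPM L η lam z →
      ∃ zs : SaddlePPM.Pt n m,
        gradient L zs = 0 ∧
        -- `zs` is near the initial point
        ‖zs - SaddlePPM.pt x₀ y₀‖ ≤
          2 * (η + α₀ / 2) / α₀ * (‖gradient L (SaddlePPM.pt x₀ y₀)‖ / (η - ρ)) ∧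
        -- the iterates converge linearly to `zs`
        (∃ q : ℝ, 0 ≤ q ∧ q < 1 ∧ ∀ k, ‖z k - zs‖ ≤ q ^ k * ‖z 0 - zs‖) ∧
        -- the rate
        ∀ k, ‖z k - zs‖ ^ 2 ≤
          (1 - 2 * lam / (2 * η / α₀ + 1) + lam ^ 2 / min 1 ((η / ρ - 1) ^ 2)) ^ k *
            ‖z 0 - zs‖ ^ 2) := by
  open SaddlePPM in
  obtain ⟨P, hP⟩ := exists_shift_rightInverse hL hweak hβ hη0 hηρ
  refine ⟨existsUnique_isProx hL hweak hβ hη0 hηρ, ⟨_, rfl, ?_, ?_, ?_⟩, ?_⟩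
  · exact lt_min (sub_pos.2 hpsdx) (sub_pos.2 hpsdy)
  · exact dominantXAt_of_lamMin hL hweak hβ hη0 hηρ hβ0 hξx hμx (min_le_left _ _)
  · exact dominantYAt_of_lamMin hL hweak hβ hη0 hηρ hβ0 hξy hμy (min_le_right _ _)
  intro α₀ hα₀ hdx hdy hsmall lam hlam0 hlam1 hlam z hz0 hz
  have hm : 0 < η - ρ := sub_pos.2 hηρ
  set z₀ := pt x₀ y₀ with hz₀
  set g := ‖gradient L z₀‖ / (η - ρ) with hg
  have hg0 : 0 ≤ g := by positivity
  set c := 2 * (η + α₀ / 2) / α₀ with hc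
  have hc0 : 0 < c := by positivity
  have hcη : c = 2 * η / α₀ + 1 := by rw [hc]; field_simp
  -- Radius about z₀ containing the proximal image of the ball of radius 2cg: Lipschitz constant
  -- times 2cg, plus the residual g.
  set r := g * (1 + 2 * c * (1 + β / (η - ρ))) with hr
  have hr0 : 0 ≤ r := by positivity
  set κ := δ / (η - ρ) with hκ
  have hloss : H * r * (1 + κ ^ 2) < α₀ / 2 := by
    refine dominance_loss_lt hα₀ hη0 hηρ hβ0 hH0 hδ0 hg0 ?_ hsmall
    rw [hg, div_mul_cancel₀ _ hm.ne']
    exact norm_gradient_le hL hδ0 hδ hx₀ hy₀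
  set α₁ := α₀ - H * r * (1 + κ ^ 2) with hα₁
  have hα₁2 : α₀ / 2 < α₁ := by linarith
  have hα₁0 : 0 < α₁ := by linarith
  have hPz : ‖P z₀ - z₀‖ ≤ g := norm_prox_sub_self_le hL hweak hηρ hP z₀
  have hdom : ∀ w ∈ Metric.closedBall z₀ (2 * (c * g)),
      VarDominantX L η α₁ κ (P w) ∧ VarDominantY L η α₁ κ (P w) := by
    intro w hw
    rw [mem_closedBall_iff_norm] at hw
    have h1 : ‖P w - z₀‖ ≤ r := by
      calc ‖P w - z₀‖ ≤ ‖P w - P z₀‖ + ‖P z₀ - z₀‖ := norm_sub_le_norm_sub_add_norm_sub _ _ _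
        _ ≤ (1 + β / (η - ρ)) * (2 * (c * g)) + g := by
          refine add_le_add ((norm_prox_sub_le hL hweak hβ hηρ hP w z₀).trans ?_) hPz
          gcongr
        _ = r := by rw [hr]; ring
    have h2 : ‖hess L (P w) - hess L z₀‖ ≤ H * r := (hH _ _).trans (by gcongr)
    exact ⟨(hdx.var hL hweak hηρ hδ0 hδ).perturb (by positivity) h2,
      (hdy.var hL hweak hηρ hδ).perturb (by positivity) h2⟩
  have hc₁ : η / α₁ + 1 < c := by
    rw [hcη, add_lt_add_iff_right, div_lt_div_iff₀ hα₁0 hα₀]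
    nlinarith
  rw [← hcη] at hlam ⊢
  refine damped_convergence hL hweak hβ hη0 hηρ hP hα₁0 hg0 hc₁ hPz hdom hlam0 hlam hz0 fun k => ?_
  obtain ⟨p, hp, hzk⟩ := hz k
  rw [isProx_iff hL hweak hβ hη0 hηρ, ← hP (z k)] at hp
  rw [hzk, eq_of_shift_eq hL hweak hηρ hp]
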